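/- **Setting.** Let $G$ be a graph (simple, undirected) in which every vertex has degree at least $d$, and for every vertex $v$ fix a set $N_+(v)$ of exactly $d$ neighbours of $v$. Let $T$ be a finite tree with root $r$; the children of $s\in V(T)$ are the neighbours of $s$ that are further from $r$ than $s$ is. Consider the following randomized algorithm (Algorithm 3). Start at an arbitrary vertex $v_1$ of $G$ and make a random walk $v_1,v_2,\dots,v_k$, where each $v_{i+1}$ is a uniformly random element of $N_+(v_i)$. Put $f(r)=v_k$ (the vertices $v_1,\dots,v_{k-1}$ are not thereby occupied). As long as $T$ is not completely embedded, take an arbitrary vertex $s\in V(T)$ which is embedded but whose children are not (the choice of $s$ may depend on everything that has happened so far). If $N_+(f(s))$ contains at least as many vertices unoccupied by vertices of $T$ as $s$ has children, embed the children of $s$ at distinct such vertices, uniformly at random; otherwise fail. **Theorem 4.1.** Let $k\ge 1$ be an integer and $0<\epsilon\le \frac1{2k}$ a real number, both constant. For every $\eta>0$ there is $d_0=d_0(k,\epsilon,\eta)$ such that the following holds for every $d\ge d_0$. Let $G$ be a graph, finite or infinite, of minimum degree at least $d$ and girth at least $2k+1$ (that is, with no cycle of length less than $2k+1$), and let $T$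 be a tree with at most $\frac14\epsilon d^k$ edges and maximum degree $\Delta(T)\le d-2\epsilon d-2$. Then for every choice of the sets $N_+(v)$, of the root $r$, of the starting vertex $v_1$ and of the rule by which the vertices $s$ are taken, Algorithm 3 outputs an embedding of $T$ in $G$ (an injective map $V(T)\to V(G)$ that sends edges to edges) with probability at least $1-\eta$. In other words, for every such tree $T$, Algorithm 3 succeeds in embedding $T$ with high probability as $d\to\infty$. -/

import Mathlib

/-!
A randomized procedure that embeds a finite rooted tree `T` (root `r`, vertex type `W`) into a
graph `G` (vertex type `V`).  A stage of the procedure is a partial placement `f : W → Option V`: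
`f w = some v` means that `w` has been placed at `v`, and `f w = none` that it has not been placed.
-/

namespace TreeEmbedding

universe u w

variable {V : Type u} {W : Type w}

/-- A fixed choice, for every vertex `v` of `G`, of a set `nbr v` of exactly `d` neighbours. -/
structure OutNeighbourhoods (G : SimpleGraph V) (d : ℕ) where
  nbr : V → Finset V
  adj : ∀ v, ∀ u ∈ nbr v, G.Adj v u
  card_nbr : ∀ v, (nbr v).card = d

open Classical in
/-- One random move from `v`: a uniformly random element of `nbr v`.
(The second branch is only there because a law has to be given when `d = 0`.) -/
noncomputable def randomMove {G : SimpleGraph V} {d : ℕ} (N : OutNeighbourhoods G d) (v : V) :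
    PMF V :=
  if h : (N.nbr v).Nonempty then PMF.uniformOfFinset (N.nbr v) h else PMF.pure v

/-- The law of the list `[v₂, …, vₘ₊₁]` of vertices visited in `m` successive random moves
started from `v₁ = v`. -/
noncomputable def walkLaw {G : SimpleGraph V} {d : ℕ} (N : OutNeighbourhoods G d) :
    ℕ → V → PMF (List V)
  | 0, _ => PMF.pure []
  | m + 1, v => (randomMove N v).bind fun x => (walkLaw N m x).map fun l => x :: l

open Classical in
/-- The children of `s` in the tree `T` rooted at `r`: the neighbours of `s` one level further
away from the root. -/
noncomputable def children [Fintype W] (T : SimpleGraph W) (r s : W) : Finset W :=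
  Finset.univ.filter fun c => T.Adj s c ∧ T.dist r c = T.dist r s + 1

open Classical in
/-- The members of `nbr v` that are not occupied in the placement `f`. -/
noncomputable def available {G : SimpleGraph V} {d : ℕ} (N : OutNeighbourhoods G d)
    (f : W → Option V) (v : V) : Finset V :=
  (N.nbr v).filter fun x => ∀ y, f y ≠ some x

open Classical in
/-- The placement in which only the root has been placed, at `v`. -/
noncomputable def placeRoot (r : W) (v : V) : W → Option V :=
  fun y => if y = r then some v else none

open Classical in
/-- The placement `f`, extended by placing the elements of `C` as prescribed by `g`. -/
noncomputable def extend (f : W → Option V) (C : Finset W) (A : Finset V) (g : C ↪ A) :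
    W → Option V :=
  fun y => if h : y ∈ C then some (g ⟨y, h⟩ : V) else f y

/-- `s` has been placed but its children (of which there is at least one) have not. -/
def Ready [Fintype W] (T : SimpleGraph W) (r : W) (f : W → Option V) (s : W) : Prop :=
  (f s).isSome ∧ (children T r s).Nonempty ∧ ∀ c ∈ children T r s, f c = none

/-- The rule by which the next tree vertex is selected.  It is arbitrary: it may depend on the list
of vertices visited in the preliminary walk and on all the placements so far (the current one is
the head of the list), and it has to select a vertex that is ready whenever there is one. -/
structure SelectionRule [Fintype W] (V : Type u) (T : SimpleGraph W) (r : W) where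
  pick : List V → List (W → Option V) → W
  pick_ready : ∀ (l : List V) (f : W → Option V) (past : List (W → Option V)),
    (∃ s, Ready T r f s) → Ready T r f (pick l (f :: past))

theorem nonempty_placements {C : Finset W} {A : Finset V} (h : C.card ≤ A.card) :
    Nonempty (C ↪ A) :=
  Function.Embedding.nonempty_of_card_le (by simpa using h)

open Classical in
/-- Place the children of `s`: if `s` is at `v` and `v` has enough available chosen neighbours, put
the children at distinct available chosen neighbours, uniformly at random; otherwise fail (`none`). -/
noncomputable def placeChildren [Fintype W] {G : SimpleGraph V} {d : ℕ} (T : SimpleGraph W) (r : W)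
    (N : OutNeighbourhoods G d) (f : W → Option V) (s : W) : PMF (Option (W → Option V)) :=
  match f s with
  | none => PMF.pure none
  | some v =>
    if h : (children T r s).card ≤ (available N f v).card then
      haveI := nonempty_placements h
      (PMF.uniformOfFintype (children T r s ↪ available N f v)).map fun g =>
        some (extend f (children T r s) (available N f v) g)
    else PMF.pure none

open Classical in
/-- The law of the result of at most `n` rounds, where `pick` selects the vertex whose children are
placed next, `past` lists the earlier placements and `f` is the current one.  The procedure stops
when the tree is completely placed, or when it fails. -/
noncomputable def runLaw [Fintype W] {G : SimpleGraph V} {d : ℕ} (T : SimpleGraph W) (r : W)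
    (N : OutNeighbourhoods G d) (pick : List (W → Option V) → W) :
    ℕ → List (W → Option V) → (W → Option V) → PMF (Option (W → Option V))
  | 0, _, f => PMF.pure (some f)
  | n + 1, past, f =>
    if ∀ y, (f y).isSome then PMF.pure (some f)
    else (placeChildren T r N f (pick (f :: past))).bind fun o =>
      match o with
      | none => PMF.pure none
      | some f' => runLaw T r N pick n (f :: past) f'

/-- The law of the output of the whole procedure.  First a random walk `v₁, v₂, …, vₖ` is made,
then the root is placed at `vₖ`, and then the children of selected vertices are placed, until the
tree is completely placed or the procedure fails.  (Every round places at least one new vertex, so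
`Fintype.card W` rounds are enough to complete any run.) -/
noncomputable def embedLaw [Fintype W] {G : SimpleGraph V} {d : ℕ} (T : SimpleGraph W) (r : W)
    (N : OutNeighbourhoods G d) (k : ℕ) (v₁ : V) (σ : SelectionRule V T r) :
    PMF (Option (W → Option V)) :=
  (walkLaw N (k - 1) v₁).bind fun l =>
    runLaw T r N (σ.pick l) (Fintype.card W) [] (placeRoot r (l.getLastD v₁))

/-- The event that the output is an embedding of `T` in `G`: all of `T` has been placed, and the
placement is an injective map that sends edges to edges. -/
def Success (G : SimpleGraph V) (T : SimpleGraph W) : Set (Option (W → Option V)) :=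
  {o | ∃ φ : SimpleGraph.Copy T G, o = some fun y => some (φ y)}

end TreeEmbedding

/-! Write `K = k - 1`. While at most `ε d` chosen neighbours of the current vertex are occupied,
there are enough free ones for the children, and a given free vertex receives a given child with
probability at most `q = 1 / ((1 - ε) d)`. So only an overload, more than `ε d` occupied chosen
neighbours at the position `v` of a ready vertex, can cause failure. The girth bounds its
probability.

Two distinct paths of length at most `k` never share both ends (`IsPathSeq.unique`). If tree
vertices `t` sit next to `v`, their branches traced back from `v` through `K` ancestors are paths of
length `K + 1`. Hence distinct `t` of depth at least `K` have distinct `K`-th ancestors, and at most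
one `t` is shallower (`eq_of_iterate_parent_eq`, `card_occupied_le`). Order the deep ones by the
time when their `K`-th ancestors were placed. The two earliest ancestors `b₁`, `b₂` leave at most `d
^ (2 * K)` possibilities for `v`: it is the unique common neighbour of a vertex `K` moves from `b₁`
and another `K` moves from `b₂`. The other `t` are fresh: the part of their branch below the `K`-th
ancestor was still unplaced just before `b₁` and `b₂` were both placed. Each such branch must follow
one prescribed path, at a cost of at most `q ^ K`.

The choices are adaptive, so this is made rigorous by a potential instead of independence. For a set
`S` of vertices with distinct `K`-th ancestors, the product of the conditional bounds `weight` does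
not increase on average, because a round advances at most one branch of `S` that is still viable
(`sum_prod_weight_le`). The potential sums these products over `b₁`, `b₂`, the candidates `v` and
the `m`-subsets `S`, divided by `M.choose m`. It is at least `1` at an overload, where all
`m`-subsets of some `M` vertices have weight `1` (`one_le_potential`). So the failure probability is
at most its initial value, which is at most `4 d ^ (4 * k) (3 / 4) ^ m` with `m` about `ε d / 4`
(`initial_potential_le`). This holds for every position of the root, hence also on average over the
preliminary walk. -/

namespace TreeEmbedding

open scoped ENNReal

/-! ### Uniqueness of short paths under the girth condition. -/

section Paths

variable {V : Type*}

/-- `x 0, …, x m` is a path of length `m` in `G`. -/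
structure IsPathSeq (G : SimpleGraph V) (x : ℕ → V) (m : ℕ) : Prop where
  adj : ∀ i < m, G.Adj (x i) (x (i + 1))
  inj : ∀ i ≤ m, ∀ j ≤ m, x i = x j → i = j

theorem IsPathSeq.mono {G : SimpleGraph V} {x : ℕ → V} {m n : ℕ} (h : IsPathSeq G x m)
    (hn : n ≤ m) : IsPathSeq G x n :=
  ⟨fun i hi => h.adj i (by omega), fun i hi j hj => h.inj i (by omega) j (by omega)⟩

theorem exists_walk_getVert {G : SimpleGraph V} (m : ℕ) (x : ℕ → V)
    (h : ∀ i < m, G.Adj (x i) (x (i + 1))) :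
    ∃ p : G.Walk (x 0) (x m), p.length = m ∧ ∀ i ≤ m, p.getVert i = x i := by
  induction m generalizing x with
  | zero => exact ⟨.nil, rfl, fun i hi => by obtain rfl : i = 0 := by omega
                                             simp⟩
  | succ m ih =>
    obtain ⟨p, hp, hv⟩ := ih (fun i => x (i + 1)) (fun i hi => h (i + 1) (by omega))
    refine ⟨.cons (h 0 (by omega)) p, by simp [hp], fun i hi => ?_⟩
    rcases i with _ | i
    · simp
    · simpa using hv i (by omega)

open Classical in
-- The union of the two paths has at most `2 * k` edges, so a cycle in it would be shorter than the
-- girth. The union is therefore acyclic, and paths in it are determined by their ends.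
theorem eq_of_isPath_of_egirth {G : SimpleGraph V} {k : ℕ}
    (hG : ((2 * k + 1 : ℕ) : ℕ∞) ≤ G.egirth) {u v : V} (p q : G.Walk u v) (hp : p.IsPath)
    (hq : q.IsPath) (hpk : p.length ≤ k) (hqk : q.length ≤ k) : p = q := by
  set H : SimpleGraph V := SimpleGraph.fromEdgeSet {e | e ∈ p.edges ∨ e ∈ q.edges} with hH
  have hHG : H ≤ G := by
    intro a b hab
    rw [hH, SimpleGraph.fromEdgeSet_adj] at hab
    rcases hab.1 with h | h
    · exact p.adj_of_mem_edges h
    · exact q.adj_of_mem_edges h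
  have hac : H.IsAcyclic := by
    intro a c hc
    have h1 : (c.mapLe hHG).IsCycle := (SimpleGraph.Walk.isCycle_mapLe hHG).2 hc
    have h2 := hG.trans (SimpleGraph.egirth_le_length h1)
    have h3 : c.length ≤ 2 * k := by
      have hsub : c.edges.toFinset ⊆ p.edges.toFinset ∪ q.edges.toFinset := by
        intro e he
        have := c.edges_subset_edgeSet (List.mem_toFinset.1 he)
        rw [hH, SimpleGraph.edgeSet_fromEdgeSet] at this
        simpa using this.1
      calc c.length = c.edges.toFinset.card := by
            rw [List.toFinset_card_of_nodup hc.edges_nodup, SimpleGraph.Walk.length_edges]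
        _ ≤ _ := (Finset.card_le_card hsub).trans (Finset.card_union_le _ _)
        _ ≤ p.edges.length + q.edges.length :=
            Nat.add_le_add (List.toFinset_card_le _) (List.toFinset_card_le _)
        _ ≤ 2 * k := by simp only [SimpleGraph.Walk.length_edges]; omega
    simp only [SimpleGraph.Walk.length_map, SimpleGraph.Walk.mapLe] at h2
    have := ENat.natCast_le_natCast.1 h2
    omega
  have hpe : ∀ e ∈ p.edges, e ∈ H.edgeSet := fun e he => by
    rw [hH, SimpleGraph.edgeSet_fromEdgeSet]
    exact ⟨Or.inl he, G.not_isDiag_of_mem_edgeSet (p.edges_subset_edgeSet he)⟩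
  have hqe : ∀ e ∈ q.edges, e ∈ H.edgeSet := fun e he => by
    rw [hH, SimpleGraph.edgeSet_fromEdgeSet]
    exact ⟨Or.inr he, G.not_isDiag_of_mem_edgeSet (q.edges_subset_edgeSet he)⟩
  have h := (hac.subsingleton_path u v).elim ⟨p.transfer H hpe, hp.transfer hpe⟩
    ⟨q.transfer H hqe, hq.transfer hqe⟩
  have h' : (p.transfer H hpe).support = (q.transfer H hqe).support := by
    rw [Subtype.ext_iff] at h
    simp only at h
    rw [h]
  rw [SimpleGraph.Walk.support_transfer, SimpleGraph.Walk.support_transfer] at h'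
  exact SimpleGraph.Walk.ext_support h'

theorem IsPathSeq.unique {G : SimpleGraph V} {k : ℕ} (hG : ((2 * k + 1 : ℕ) : ℕ∞) ≤ G.egirth)
    {x y : ℕ → V} {m n : ℕ} (hx : IsPathSeq G x m) (hy : IsPathSeq G y n) (hm : m ≤ k)
    (hn : n ≤ k) (h0 : x 0 = y 0) (h1 : x m = y n) : m = n ∧ ∀ i ≤ m, x i = y i := by
  obtain ⟨p, hp, hpv⟩ := exists_walk_getVert m x hx.adj
  obtain ⟨q, hq, hqv⟩ := exists_walk_getVert n y hy.adj
  have hpp : p.IsPath := by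
    rw [← SimpleGraph.Walk.IsPath.getVert_injOn_iff]
    intro i hi j hj hij
    simp only [hp, Set.mem_ofPred_eq] at hi hj
    rw [hpv i hi, hpv j hj] at hij
    exact hx.inj i hi j hj hij
  have hqp : q.IsPath := by
    rw [← SimpleGraph.Walk.IsPath.getVert_injOn_iff]
    intro i hi j hj hij
    simp only [hq, Set.mem_ofPred_eq] at hi hj
    rw [hqv i hi, hqv j hj] at hij
    exact hy.inj i hi j hj hij
  have h := eq_of_isPath_of_egirth hG p (q.copy h0.symm h1.symm) hpp (by simpa using hqp)
    (by omega) (by simpa [hq] using hn)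
  have hl : m = n := by rw [← hp, h]; simpa using hq
  refine ⟨hl, fun i hi => ?_⟩
  rw [← hpv i hi, h, SimpleGraph.Walk.getVert_copy, hqv i (by omega)]

end Paths

/-! ### Parents, ancestors and depth in a rooted tree. -/

section Tree

variable {W : Type*}

open Classical in
/-- The parent of `c` in the tree `T` rooted at `r`; the root is its own parent. -/
noncomputable def parent (T : SimpleGraph W) (r c : W) : W :=
  if h : ∃ p, T.Adj p c ∧ T.dist r c = T.dist r p + 1 then h.choose else c

theorem parent_root (T : SimpleGraph W) (r : W) : parent T r r = r := by
  rw [parent, dif_neg]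
  rintro ⟨p, -, h⟩
  simp at h

variable {T : SimpleGraph W} {r : W}

theorem parent_spec (hT : T.IsTree) {c : W} (hc : c ≠ r) :
    T.Adj (parent T r c) c ∧ T.dist r c = T.dist r (parent T r c) + 1 := by
  have h : ∃ p, T.Adj p c ∧ T.dist r c = T.dist r p + 1 := by
    obtain ⟨p, hp⟩ := hT.connected.exists_walk_length_eq_dist c r
    cases p with
    | nil => exact absurd rfl hc
    | cons hadj p =>
      rename_i w
      refine ⟨w, hadj.symm, ?_⟩
      simp only [SimpleGraph.Walk.length_cons] at hp
      have h1 := SimpleGraph.dist_le p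
      have h2 := hT.dist_eq_dist_add_one_of_adj r hadj
      rw [SimpleGraph.dist_comm (u := r), SimpleGraph.dist_comm (u := r)] at h2 ⊢
      omega
  rw [parent, dif_pos h]
  exact h.choose_spec

/-- Any neighbour of `c` one level closer to the root is the second vertex of a shortest path from
`c` to `r`, and a tree has only one such path. -/
theorem eq_parent (hT : T.IsTree) {c p : W} (ha : T.Adj p c)
    (hd : T.dist r c = T.dist r p + 1) : p = parent T r c := by
  have hc : c ≠ r := by rintro rfl; simp at hd
  obtain ⟨h1, h2⟩ := parent_spec hT hc
  have key : ∀ a, T.Adj a c → T.dist r c = T.dist r a + 1 →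
      ∃ w : T.Walk c r, w.IsPath ∧ w.getVert 1 = a := by
    intro a ha hd
    obtain ⟨w, hw⟩ := hT.connected.exists_walk_length_eq_dist a r
    refine ⟨.cons ha.symm w, ?_, by simp⟩
    apply SimpleGraph.Walk.isPath_of_length_eq_dist
    rw [SimpleGraph.Walk.length_cons, hw, SimpleGraph.dist_comm, ← hd, SimpleGraph.dist_comm]
  obtain ⟨w, hw, rfl⟩ := key p ha hd
  obtain ⟨w', hw', e⟩ := key _ h1 h2
  rw [← e, (hT.existsUnique_path c r).unique hw hw']

theorem adj_iff_parent (hT : T.IsTree) {a b : W} (h : T.Adj a b) :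
    (b ≠ r ∧ parent T r b = a) ∨ (a ≠ r ∧ parent T r a = b) := by
  rcases hT.dist_eq_dist_add_one_of_adj r h with h' | h'
  · exact Or.inr ⟨by rintro rfl; simp at h', (eq_parent hT h.symm h').symm⟩
  · exact Or.inl ⟨by rintro rfl; simp at h', (eq_parent hT h h').symm⟩

theorem mem_children [Fintype W] (hT : T.IsTree) {s c : W} :
    c ∈ children T r s ↔ c ≠ r ∧ parent T r c = s := by
  simp only [children, Finset.mem_filter, Finset.mem_univ, true_and]
  constructor
  · rintro ⟨h1, h2⟩
    exact ⟨by rintro rfl; simp at h2, (eq_parent hT h1 h2).symm⟩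
  · rintro ⟨h1, rfl⟩
    exact parent_spec hT h1

theorem dist_parent (hT : T.IsTree) (c : W) : T.dist r (parent T r c) = T.dist r c - 1 := by
  by_cases h : c = r
  · subst h; simp [parent_root]
  · have := (parent_spec hT h).2; omega

theorem dist_iterate_parent (hT : T.IsTree) (i : ℕ) (c : W) :
    T.dist r ((parent T r)^[i] c) = T.dist r c - i := by
  induction i with
  | zero => simp
  | succ i ih => rw [Function.iterate_succ_apply', dist_parent hT, ih]; omega

theorem iterate_parent_ne_root (hT : T.IsTree) {i : ℕ} {c : W} (h : i < T.dist r c) :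
    (parent T r)^[i] c ≠ r := by
  intro h'
  have := dist_iterate_parent (r := r) hT i c
  rw [h'] at this
  simp at this
  omega

theorem iterate_parent_eq_root (hT : T.IsTree) {i : ℕ} {c : W} (h : T.dist r c ≤ i) :
    (parent T r)^[i] c = r := by
  have := dist_iterate_parent (r := r) hT i c
  rw [Nat.sub_eq_zero_of_le h, hT.connected.dist_eq_zero_iff] at this
  exact this.symm

theorem iterate_parent_injective (hT : T.IsTree) {i j : ℕ} {c : W} (hi : i ≤ T.dist r c)
    (hj : j ≤ T.dist r c) (h : (parent T r)^[i] c = (parent T r)^[j] c) : i = j := by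
  have h1 := dist_iterate_parent (r := r) hT i c
  have h2 := dist_iterate_parent (r := r) hT j c
  rw [h] at h1
  omega

theorem card_children_le [Fintype W] [DecidableRel T.Adj] (s : W) :
    (children T r s).card ≤ T.maxDegree := by
  refine le_trans (Finset.card_le_card ?_) (T.degree_le_maxDegree s)
  intro c hc
  simp only [children, Finset.mem_filter] at hc
  simpa using hc.2.1

end Tree


/-! ### Invariants of partial placements, and failure bounded by a potential. -/

section Placement

variable {V W : Type*} {G : SimpleGraph V} {d : ℕ} {T : SimpleGraph W} {r : W}

/-- The placement `f'` extends `f`. -/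
def Extends (f f' : W → Option V) : Prop := ∀ x v, f x = some v → f' x = some v

theorem Extends.isSome {f f' : W → Option V} (h : Extends f f') {x : W} (hx : (f x).isSome) :
    (f' x).isSome := by
  obtain ⟨v, hv⟩ := Option.isSome_iff_exists.1 hx
  exact Option.isSome_iff_exists.2 ⟨v, h x v hv⟩

theorem Extends.eq_none {f f' : W → Option V} (h : Extends f f') {x : W} (hx : f' x = none) :
    f x = none := by
  by_contra hne
  have := h.isSome (Option.isSome_iff_ne_none.2 hne)
  simp [hx] at this

/-- The invariants of the placements that occur in the procedure. -/
structure Valid (T : SimpleGraph W) (r : W) (N : OutNeighbourhoods G d) (f : W → Option V) :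
    Prop where
  root : (f r).isSome
  parent : ∀ c, (f c).isSome → (f (parent T r c)).isSome
  sibling : ∀ c, c ≠ r → (f c).isSome → ∀ c', c' ≠ r →
    TreeEmbedding.parent T r c' = TreeEmbedding.parent T r c → (f c').isSome
  inj : ∀ x y v, f x = some v → f y = some v → x = y
  edge : ∀ c, c ≠ r → ∀ x w, f c = some x → f (TreeEmbedding.parent T r c) = some w → x ∈ N.nbr w

variable {N : OutNeighbourhoods G d}

theorem Valid.iterate_parent {f : W → Option V} (hf : Valid T r N f) {c : W}
    (hc : (f c).isSome) (i : ℕ) : (f ((TreeEmbedding.parent T r)^[i] c)).isSome := by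
  induction i with
  | zero => exact hc
  | succ i ih => rw [Function.iterate_succ_apply']; exact hf.parent _ ih

theorem Valid.iterate_parent_eq_none {f : W → Option V} (hf : Valid T r N f) {c : W} {i j : ℕ}
    (hij : j ≤ i) (hc : f ((TreeEmbedding.parent T r)^[i] c) = none) :
    f ((TreeEmbedding.parent T r)^[j] c) = none := by
  by_contra hne
  have := hf.iterate_parent (Option.isSome_iff_ne_none.2 hne) (i - j)
  rw [← Function.iterate_add_apply, Nat.sub_add_cancel hij, hc] at this
  simp at this

theorem valid_placeRoot (v : V) : Valid T r N (placeRoot r v) := by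
  have h : ∀ c, (placeRoot r v c).isSome → c = r := by
    intro c hc
    by_contra hne
    simp [placeRoot, hne] at hc
  refine ⟨by simp [placeRoot], ?_, ?_, ?_, ?_⟩
  · intro c hc
    rw [h c hc, parent_root]
    simp [placeRoot]
  · intro c hc hc'
    exact absurd (h c hc') hc
  · intro x y w hx hy
    rw [h x (by simp [hx]), h y (by simp [hy])]
  · intro c hc x w hx
    exact absurd (h c (by simp [hx])) hc

section Extend

variable {f : W → Option V} {C : Finset W} {A : Finset V} (g : C ↪ A)

theorem extend_of_mem {y : W} (h : y ∈ C) : extend f C A g y = some (g ⟨y, h⟩ : V) := by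
  simp [extend, h]

theorem extend_of_notMem {y : W} (h : y ∉ C) : extend f C A g y = f y := by
  simp [extend, h]

theorem extends_extend (h : ∀ c ∈ C, f c = none) : Extends f (extend f C A g) := by
  intro x v hx
  rw [extend_of_notMem g, hx]
  intro hxC
  simp [h x hxC] at hx

end Extend

theorem Valid.extend [Fintype W] (hT : T.IsTree) {f : W → Option V} (hf : Valid T r N f) {s : W}
    (hs : Ready T r f s) {v : V} (hv : f s = some v)
    (g : children T r s ↪ available N f v) :
    Valid T r N (extend f (children T r s) (available N f v) g) := by
  have hext := extends_extend g hs.2.2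
  have key : ∀ c, c ∉ children T r s →
      (TreeEmbedding.extend f (children T r s) (available N f v) g c).isSome → (f c).isSome := by
    intro c hc h
    rwa [extend_of_notMem g hc] at h
  have havail : ∀ c (hc : c ∈ children T r s), (g ⟨c, hc⟩ : V) ∈ N.nbr v ∧
      ∀ y, f y ≠ some (g ⟨c, hc⟩ : V) := by
    intro c hc
    have := (g ⟨c, hc⟩).2
    simpa only [available, Finset.mem_filter] using this
  refine ⟨hext.isSome hf.root, ?_, ?_, ?_, ?_⟩
  · intro c h
    by_cases hc : c ∈ children T r s
    · rw [((mem_children hT).1 hc).2]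
      exact hext.isSome hs.1
    · exact hext.isSome (hf.parent c (key c hc h))
  · intro c hcr h c' hcr' hp
    by_cases hc : c ∈ children T r s
    · have hc' : c' ∈ children T r s :=
        (mem_children hT).2 ⟨hcr', hp.trans ((mem_children hT).1 hc).2⟩
      rw [extend_of_mem g hc']
      rfl
    · exact hext.isSome (hf.sibling c hcr (key c hc h) c' hcr' hp)
  · intro x y w hx hy
    by_cases hxC : x ∈ children T r s <;> by_cases hyC : y ∈ children T r s
    · rw [extend_of_mem g hxC, ← hy, extend_of_mem g hyC] at hx
      have := g.injective (Subtype.ext (Option.some.inj hx))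
      simpa using this
    · rw [extend_of_mem g hxC] at hx
      rw [extend_of_notMem g hyC, ← hx] at hy
      exact absurd hy ((havail x hxC).2 y)
    · rw [extend_of_mem g hyC] at hy
      rw [extend_of_notMem g hxC, ← hy] at hx
      exact absurd hx ((havail y hyC).2 x)
    · rw [extend_of_notMem g hxC] at hx
      rw [extend_of_notMem g hyC] at hy
      exact hf.inj x y w hx hy
  · intro c hcr x w hx hw
    by_cases hc : c ∈ children T r s
    · rw [((mem_children hT).1 hc).2, hext s v hv] at hw
      rw [extend_of_mem g hc] at hx
      obtain rfl := Option.some.inj hx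
      obtain rfl := Option.some.inj hw
      exact (havail c hc).1
    · rw [extend_of_notMem g hc] at hx
      obtain ⟨w', hw'⟩ := Option.isSome_iff_exists.1 (hf.parent c (by simp [hx]))
      have := hext _ _ hw'
      rw [hw] at this
      exact hf.edge c hcr x w hx (hw'.trans this.symm)

/-- An unplaced vertex of least depth has a placed parent. Siblings are placed together, so none of
that parent's children is placed. -/
theorem Valid.exists_ready [Fintype W] (hT : T.IsTree) {f : W → Option V} (hf : Valid T r N f)
    (h : ¬ ∀ y, (f y).isSome) : ∃ s, Ready T r f s := by
  push Not at h
  have hfin : ∃ n, ∃ y, ¬ (f y).isSome ∧ T.dist r y = n := by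
    obtain ⟨y, hy⟩ := h
    exact ⟨_, y, hy, rfl⟩
  classical
  obtain ⟨y, hy, hyn⟩ := Nat.find_spec hfin
  have hyr : y ≠ r := by
    rintro rfl
    exact hy hf.root
  have hp : (f (TreeEmbedding.parent T r y)).isSome := by
    by_contra hne
    refine Nat.find_min hfin ?_ ⟨_, hne, rfl⟩
    rw [← hyn]
    have := (parent_spec hT hyr).2
    omega
  refine ⟨TreeEmbedding.parent T r y, hp, ⟨y, (mem_children hT).2 ⟨hyr, rfl⟩⟩, fun c hc => ?_⟩
  obtain ⟨hcr, hcp⟩ := (mem_children hT).1 hc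
  by_contra hne
  exact hy (hf.sibling c hcr (Option.isSome_iff_ne_none.2 hne) y hyr hcp.symm)

theorem Valid.mem_success (hT : T.IsTree) {f : W → Option V} (hf : Valid T r N f)
    (h : ∀ y, (f y).isSome) : some f ∈ Success G T := by
  choose φ hφ using fun y => Option.isSome_iff_exists.1 (h y)
  refine ⟨⟨⟨φ, fun {a b} hab => ?_⟩, fun a b hab => ?_⟩, ?_⟩
  · rcases adj_iff_parent (r := r) hT hab with ⟨hb, hp⟩ | ⟨ha, hp⟩
    · exact N.adj _ _ (hf.edge b hb _ _ (hφ b) (hp ▸ hφ a))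
    · exact (N.adj _ _ (hf.edge a ha _ _ (hφ a) (hp ▸ hφ b))).symm
  · exact hf.inj a b (φ a) (hφ a) (by rw [hφ b]; exact congrArg some hab.symm)
  · exact congrArg some (funext hφ)

open Classical in
/-- The members of `nbr v` that are occupied in the placement `f`. -/
noncomputable def occupied (N : OutNeighbourhoods G d) (f : W → Option V) (v : V) : Finset V :=
  (N.nbr v).filter fun x => ∃ y, f y = some x

theorem card_available_add_card_occupied (f : W → Option V) (v : V) :
    (available N f v).card + (occupied N f v).card = d := by
  classical
  have h := Finset.card_filter_add_card_filter_not (s := N.nbr v) (fun x => ∃ y, f y = some x)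
  rw [N.card_nbr v] at h
  simp only [not_exists] at h
  rw [add_comm, occupied, available]
  exact h

open Classical in
theorem card_unplaced_extend_lt [Fintype W] {f : W → Option V} {C : Finset W} {A : Finset V}
    (g : C ↪ A) (hC : C.Nonempty) (h : ∀ c ∈ C, f c = none) :
    (Finset.univ.filter fun y => extend f C A g y = none).card <
      (Finset.univ.filter fun y => f y = none).card := by
  apply Finset.card_lt_card
  obtain ⟨c, hc⟩ := hC
  refine ⟨fun y hy => ?_, fun hsub => ?_⟩
  · simp only [Finset.mem_filter, Finset.mem_univ, true_and] at hy ⊢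
    exact (extends_extend g h).eq_none hy
  · have := hsub (show c ∈ _ by simpa using h c hc)
    simp [extend_of_mem g hc] at this

open Classical in
theorem placeChildren_eq [Fintype W] {f : W → Option V} {s : W} {v : V} (hv : f s = some v)
    (h : (children T r s).card ≤ (available N f v).card) :
    haveI := nonempty_placements h
    placeChildren T r N f s =
      (PMF.uniformOfFintype (children T r s ↪ available N f v)).map fun g =>
        some (extend f (children T r s) (available N f v) g) := by
  unfold placeChildren
  split
  · simp_all
  · rename_i w hw
    obtain rfl : w = v := by simpa [hv] using hw.symm
    rw [dif_pos h]

open Classical in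
/-- If `pot` is a nonnegative function of the history that does not increase on average in a round
in which the picked vertex has at most `ε d` occupied chosen neighbours, and is at least `1` when
the picked vertex has more of them, then the procedure fails with probability at most `pot`. -/
theorem one_le_success_add_potential [Fintype W] (hT : T.IsTree) {ε : ℝ}
    (hΔ : ∀ s, ((children T r s).card : ℝ) ≤ d - ε * d)
    (pick : List (W → Option V) → W)
    (hpick : ∀ f past, (∃ s, Ready T r f s) → Ready T r f (pick (f :: past)))
    (pot : List (W → Option V) → ℝ≥0∞)
    (hstep : ∀ f past s v, Valid T r N f → (∀ g ∈ past, Extends g f) → Ready T r f s →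
      f s = some v → ((occupied N f v).card : ℝ) ≤ ε * d →
      (children T r s).card ≤ (available N f v).card →
      ∑ g : children T r s ↪ available N f v,
        (Fintype.card (children T r s ↪ available N f v) : ℝ≥0∞)⁻¹ *
          pot (extend f (children T r s) (available N f v) g :: f :: past) ≤ pot (f :: past))
    (hover : ∀ f past s v, Valid T r N f → (∀ g ∈ past, Extends g f) → Ready T r f s →
      f s = some v → ε * d < ((occupied N f v).card : ℝ) → 1 ≤ pot (f :: past))
    (n : ℕ) (past : List (W → Option V)) (f : W → Option V) (hf : Valid T r N f)
    (hpast : ∀ g ∈ past, Extends g f)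
    (hn : (Finset.univ.filter fun y => f y = none).card ≤ n) :
    1 ≤ (runLaw T r N pick n past f).toOuterMeasure (Success G T) + pot (f :: past) := by
  have hdone : (∀ y, (f y).isSome) →
      1 ≤ (PMF.pure (some f)).toOuterMeasure (Success G T) + pot (f :: past) := by
    intro h
    rw [PMF.toOuterMeasure_pure_apply, if_pos (hf.mem_success hT h)]
    exact le_self_add
  induction n generalizing past f with
  | zero =>
    rw [runLaw]
    apply hdone
    intro y
    have := Finset.card_eq_zero.1 (Nat.le_zero.1 hn)
    rw [Finset.filter_eq_empty_iff] at this
    exact Option.isSome_iff_ne_none.2 (this (Finset.mem_univ y))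
  | succ n ih =>
    rw [runLaw]
    by_cases hall : ∀ y, (f y).isSome
    · rw [if_pos hall]
      exact hdone hall
    rw [if_neg hall]
    set s := pick (f :: past)
    have hs : Ready T r f s := hpick f past (hf.exists_ready hT hall)
    obtain ⟨v, hv⟩ := Option.isSome_iff_exists.1 hs.1
    by_cases hocc : ((occupied N f v).card : ℝ) ≤ ε * d
    swap
    -- At an overload the potential alone is at least `1`, whatever the round does.
    · exact (hover f past s v hf hpast hs hv (not_le.1 hocc)).trans le_add_self
    have hle : (children T r s).card ≤ (available N f v).card := by
      have h1 : ((available N f v).card : ℝ) + (occupied N f v).card = d := by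
        exact_mod_cast card_available_add_card_occupied (N := N) f v
      have h2 := hΔ s
      have h3 : ((children T r s).card : ℝ) ≤ (available N f v).card := by linarith
      exact_mod_cast h3
    have := nonempty_placements hle
    rw [placeChildren_eq hv hle, PMF.bind_map, PMF.toOuterMeasure_bind_apply, tsum_fintype]
    refine le_trans ?_ (add_le_add_right
      (hstep f past s v hf hpast hs hv hocc hle) _)
    rw [← Finset.sum_add_distrib]
    have hone : (1 : ℝ≥0∞) = ∑ g : children T r s ↪ available N f v,
        (Fintype.card (children T r s ↪ available N f v) : ℝ≥0∞)⁻¹ := by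
      rw [Finset.sum_const, Finset.card_univ, nsmul_eq_mul, ENNReal.mul_inv_cancel]
      · exact_mod_cast Fintype.card_ne_zero
      · exact ENNReal.natCast_ne_top _
    rw [hone]
    refine Finset.sum_le_sum fun g _ => ?_
    rw [PMF.uniformOfFintype_apply, ← mul_add]
    refine le_mul_of_one_le_right zero_le ?_
    have hf' := hf.extend hT hs hv g
    refine ih (f :: past) _ hf' ?_ ?_ ?_
    · intro g' hg'
      have hext := extends_extend g hs.2.2
      rcases List.mem_cons.1 hg' with rfl | hg'
      · exact hext
      · exact fun x w hx => hext x w (hpast g' hg' x w hx)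
    · have := card_unplaced_extend_lt g hs.2.1 hs.2.2
      omega
    · intro h
      rw [PMF.toOuterMeasure_pure_apply, if_pos (hf'.mem_success hT h)]
      exact le_self_add

end Placement


/-- Composing with a transposition of `β` matches the fibres over any two values of `g c`, so a
uniformly random injection has uniform marginals. -/
theorem card_filter_embedding_eq_mul_card {α β : Type*} [Fintype α] [Fintype β] [DecidableEq α]
    [DecidableEq β] (c : α) (a : β) :
    (Finset.univ.filter fun g : α ↪ β => g c = a).card * Fintype.card β =
      Fintype.card (α ↪ β) := by
  have h : ∀ a', (Finset.univ.filter fun g : α ↪ β => g c = a').card =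
      (Finset.univ.filter fun g : α ↪ β => g c = a).card := by
    intro a'
    refine Finset.card_bij (fun g _ => g.trans (Equiv.swap a' a).toEmbedding) ?_ ?_ ?_
    · intro g hg
      simp only [Finset.mem_filter, Finset.mem_univ, true_and] at hg ⊢
      simp [hg]
    · intro g _ g' _ h
      ext x
      have := DFunLike.congr_fun h x
      simpa using this
    · intro g hg
      simp only [Finset.mem_filter, Finset.mem_univ, true_and] at hg
      refine ⟨g.trans (Equiv.swap a' a).toEmbedding, by simp [hg], ?_⟩
      ext x
      simp
  have hsum := Finset.card_eq_sum_card_fiberwise (s := (Finset.univ : Finset (α ↪ β)))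
    (f := fun g : α ↪ β => g c) (t := Finset.univ)
    (fun _ _ => Finset.mem_coe.2 (Finset.mem_univ _))
  rw [Finset.sum_congr rfl fun a' _ => h a', Finset.card_univ] at hsum
  simp [hsum, mul_comm]

open Classical in
theorem sum_embedding_ite_le {V W : Type*} {C : Finset W} {A : Finset V} (c : C) (a : V) (z : ℝ≥0∞) :
    ∑ g : C ↪ A, (Fintype.card (C ↪ A) : ℝ≥0∞)⁻¹ * (if (g c : V) = a then z else 0) ≤
      (A.card : ℝ≥0∞)⁻¹ * z := by
  by_cases ha : a ∈ A
  swap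
  · rw [Finset.sum_eq_zero]
    · exact zero_le
    · intro g _
      rw [if_neg, mul_zero]
      intro h
      exact ha (h ▸ (g c).2 : a ∈ A)
  rw [← Finset.mul_sum, ← Finset.sum_filter, Finset.sum_const, nsmul_eq_mul, ← mul_assoc]
  gcongr
  have h := card_filter_embedding_eq_mul_card c (⟨a, ha⟩ : A)
  have hf : (Finset.univ.filter fun g : C ↪ A => (g c : V) = a) =
      Finset.univ.filter fun g : C ↪ A => g c = ⟨a, ha⟩ := by
    ext g
    simp [Subtype.ext_iff]
  have hA : A.card ≠ 0 := Finset.card_ne_zero_of_mem ha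
  rw [hf, mul_comm, ← div_eq_mul_inv]
  apply ENNReal.div_le_of_le_mul
  rw [mul_comm, ← div_eq_mul_inv, ENNReal.le_div_iff_mul_le (by simp [hA]) (by simp)]
  rw [Fintype.card_coe] at h
  exact_mod_cast h.le

/-! ### The conditional bound for a branch, and its supermartingale property. -/

section Weight

variable {V W : Type*} {G : SimpleGraph V} {d : ℕ} {T : SimpleGraph W} {r : W}

/-- The part of the branch from the `K`-th ancestor of `t` to `t` that is already placed can be
continued to a path of length `K + 1` from the position of that ancestor to `u`. -/
def Compatible (G : SimpleGraph V) (T : SimpleGraph W) (r : W) (K : ℕ) (u : V) (f : W → Option V)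
    (t : W) : Prop :=
  (f ((parent T r)^[K] t)).isSome → ∃ x, IsPathSeq G x (K + 1) ∧ x 0 = u ∧
    ∀ i < K + 1, ∀ y, f ((parent T r)^[i] t) = some y → x (i + 1) = y

open Classical in
/-- The number of vertices not yet placed among `t` and its first `K - 1` ancestors. -/
noncomputable def unplacedCount (T : SimpleGraph W) (r : W) (K : ℕ) (f : W → Option V) (t : W) : ℕ :=
  ((Finset.range K).filter fun i => f ((parent T r)^[i] t) = none).card

open Classical in
/-- An upper bound for the conditional probability that `t` is placed next to `u`, given the
placement `f`, when a fixed vertex is hit with probability at most `q` in each step. -/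
noncomputable def weight (G : SimpleGraph V) (T : SimpleGraph W) (r : W) (K : ℕ) (q : ℝ≥0∞) (u : V)
    (f : W → Option V) (t : W) : ℝ≥0∞ :=
  if Compatible G T r K u f t then q ^ unplacedCount T r K f t else 0

variable {K : ℕ} {q : ℝ≥0∞} {u : V}

theorem Compatible.of_extends {f f' : W → Option V} {t : W} (h : Compatible G T r K u f' t)
    (hff : Extends f f') : Compatible G T r K u f t := by
  intro hb
  obtain ⟨x, hx, h0, hi⟩ := h (hff.isSome hb)
  exact ⟨x, hx, h0, fun i hiK y hy => hi i hiK y (hff _ _ hy)⟩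

theorem unplacedCount_extend_of_notMem {f : W → Option V} {C : Finset W} {A : Finset V} (g : C ↪ A)
    {t : W} (h : ∀ i < K, (parent T r)^[i] t ∉ C) :
    unplacedCount T r K (extend f C A g) t = unplacedCount T r K f t := by
  unfold unplacedCount
  congr 1
  apply Finset.filter_congr
  intro i hi
  rw [extend_of_notMem g (h i (Finset.mem_range.1 hi))]

theorem weight_extend_le {f : W → Option V} {C : Finset W} {A : Finset V} (g : C ↪ A)
    {t : W} (hC : ∀ c ∈ C, f c = none) (h : ∀ i < K, (parent T r)^[i] t ∉ C) :
    weight G T r K q u (extend f C A g) t ≤ weight G T r K q u f t := by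
  unfold weight
  by_cases hc : Compatible G T r K u (extend f C A g) t
  · rw [if_pos hc, if_pos (hc.of_extends (extends_extend g hC)), unplacedCount_extend_of_notMem g h]
  · rw [if_neg hc]
    exact zero_le

/-- Since `t` has depth at least `K`, its first ancestors are distinct, so only one of them can be a
child of `s`. -/
theorem unplacedCount_extend_add_one [Fintype W] (hT : T.IsTree) {f : W → Option V} {s : W}
    {A : Finset V} (g : children T r s ↪ A) (hC : ∀ c ∈ children T r s, f c = none)
    {t : W} (ht : K ≤ T.dist r t) {i : ℕ} (hi : i < K)
    (h : (parent T r)^[i] t ∈ children T r s) :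
    unplacedCount T r K (extend f (children T r s) A g) t + 1 = unplacedCount T r K f t := by
  classical
  have hne : ∀ j < K, j ≠ i → (parent T r)^[j] t ∉ children T r s := by
    intro j hj hji hmem
    apply hji
    obtain ⟨h1, h2⟩ := (mem_children hT).1 hmem
    obtain ⟨h3, h4⟩ := (mem_children hT).1 h
    rw [← h4, ← Function.iterate_succ_apply' (parent T r),
      ← Function.iterate_succ_apply' (parent T r)] at h2
    have := iterate_parent_injective hT (by omega) (by omega) h2
    omega
  unfold unplacedCount
  rw [← Finset.card_insert_of_notMem (a := i)]
  · congr 1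
    ext j
    simp only [Finset.mem_insert, Finset.mem_filter, Finset.mem_range]
    by_cases hji : j = i
    · subst hji
      simp [hi, hC _ h]
    · simp only [hji, false_or]
      refine and_congr_right fun hj => ?_
      rw [extend_of_notMem g (hne j hj hji)]
  · simp [extend_of_mem g h]

/-- Both paths, cut off where they meet the position `v` of `s`, join the same ends and so coincide.
Thus the level of `s` on a viable branch is forced, and so is the only useful position for its
child. -/
theorem Compatible.index_unique (hG : ((2 * (K + 1) + 1 : ℕ) : ℕ∞) ≤ G.egirth) {f : W → Option V} {s : W} {v : V}
    (hv : f s = some v) {t t' : W} {i i' : ℕ} (hi : i < K) (hi' : i' < K)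
    (ht : (parent T r)^[i + 1] t = s) (ht' : (parent T r)^[i' + 1] t' = s) {x x' : ℕ → V}
    (hx : IsPathSeq G x (K + 1)) (hx' : IsPathSeq G x' (K + 1)) (h0 : x 0 = x' 0)
    (hxf : ∀ i < K + 1, ∀ y, f ((parent T r)^[i] t) = some y → x (i + 1) = y)
    (hxf' : ∀ i < K + 1, ∀ y, f ((parent T r)^[i] t') = some y → x' (i + 1) = y) :
    i = i' ∧ x (i + 1) = x' (i + 1) := by
  have h1 := hxf (i + 1) (by omega) v (ht ▸ hv)
  have h2 := hxf' (i' + 1) (by omega) v (ht' ▸ hv)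
  obtain ⟨h3, h4⟩ := (hx.mono (n := i + 1 + 1) (by omega)).unique hG
    (hx'.mono (n := i' + 1 + 1) (by omega)) (by omega) (by omega) h0 (h1.trans h2.symm)
  exact ⟨by omega, h4 (i + 1) (by omega)⟩

open Classical in
/-- One round does not increase the expectation of a product of weights over tree vertices with
distinct `K`-th ancestors. -/
theorem sum_prod_weight_le [Fintype W] (hT : T.IsTree)
    (hG : ((2 * (K + 1) + 1 : ℕ) : ℕ∞) ≤ G.egirth) {N : OutNeighbourhoods G d} {f : W → Option V}
    (hf : Valid T r N f) {s : W} {v : V} (hs : Ready T r f s) (hv : f s = some v) {A : Finset V}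
    (hq : (A.card : ℝ≥0∞)⁻¹ ≤ q) (S : Finset W) (hdeep : ∀ t ∈ S, K ≤ T.dist r t)
    (hb : Set.InjOn (parent T r)^[K] (S : Set W)) :
    ∑ g : children T r s ↪ A, (Fintype.card (children T r s ↪ A) : ℝ≥0∞)⁻¹ *
        ∏ t ∈ S, weight G T r K q u (extend f (children T r s) A g) t ≤
      ∏ t ∈ S, weight G T r K q u f t := by
  by_cases hcomp : ∀ t ∈ S, Compatible G T r K u f t
  swap
  -- Compatibility once lost is never regained, so a vanishing product stays zero.
  · push Not at hcomp
    obtain ⟨t, htS, ht⟩ := hcomp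
    rw [Finset.sum_eq_zero]
    · exact zero_le
    · intro g _
      rw [Finset.prod_eq_zero htS, mul_zero]
      rw [weight, if_neg fun h => ht (h.of_extends (extends_extend g hs.2.2))]
  by_cases hex : ∃ t ∈ S, ∃ i < K, (parent T r)^[i] t ∈ children T r s
  swap
  · push Not at hex
    calc _ ≤ ∑ g : children T r s ↪ A, (Fintype.card (children T r s ↪ A) : ℝ≥0∞)⁻¹ * ∏ t ∈ S, weight G T r K q u f t := by
          gcongr with g _ t ht
          exact weight_extend_le g hs.2.2 (hex t ht)
      _ ≤ _ := by
          rw [Finset.sum_const, Finset.card_univ, nsmul_eq_mul, ← mul_assoc]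
          exact mul_le_of_le_one_left zero_le (ENNReal.mul_inv_le_one _)
  obtain ⟨t₀, ht₀, i, hiK, hi⟩ := hex
  have hsucc : ∀ t j, (parent T r)^[j] t ∈ children T r s → (parent T r)^[j + 1] t = s := by
    intro t j h
    rw [Function.iterate_succ_apply']
    exact ((mem_children hT).1 h).2
  have hplaced : ∀ t j, j < K → (parent T r)^[j] t ∈ children T r s → (f ((parent T r)^[K] t)).isSome := by
    intro t j hj h
    have := hf.iterate_parent (c := s) (by simp [hv]) (K - (j + 1))
    rwa [← hsucc t j h, ← Function.iterate_add_apply, Nat.sub_add_cancel (by omega)] at this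
  obtain ⟨x, hx, hx0, hxf⟩ := hcomp t₀ ht₀ (hplaced t₀ i hiK hi)
  -- A second viable branch through a child of `s` would have `s` at the same level, hence the same
  -- `K`-th ancestor, against injectivity on `S`.
  have hother : ∀ t ∈ S.erase t₀, ∀ j < K, (parent T r)^[j] t ∉ children T r s := by
    intro t ht j hj hmem
    obtain ⟨hne, htS⟩ := Finset.mem_erase.1 ht
    obtain ⟨x', hx', hx0', hxf'⟩ := hcomp t htS (hplaced t j hj hmem)
    obtain ⟨hij, -⟩ := Compatible.index_unique hG hv hiK hj (hsucc _ _ hi) (hsucc _ _ hmem)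
      hx hx' (hx0.trans hx0'.symm) hxf hxf'
    subst hij
    apply hne
    apply hb htS ht₀
    have h1 : ∀ z, (parent T r)^[i + 1] z = s →
        (parent T r)^[K] z = (parent T r)^[K - (i + 1)] s := by
      intro z hz
      rw [← hz, ← Function.iterate_add_apply, Nat.sub_add_cancel (by omega)]
    rw [h1 _ (hsucc _ _ hmem), h1 _ (hsucc _ _ hi)]
  obtain ⟨m, hm⟩ : ∃ m, unplacedCount T r K f t₀ = m + 1 := by
    apply Nat.exists_eq_succ_of_ne_zero
    apply Finset.card_ne_zero_of_mem (a := i)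
    simp [hiK, hs.2.2 _ hi]
  -- The branch of `t₀` survives only if the child lands on the prescribed vertex. This has
  -- probability at most `q`, which pays for the factor `q` gained by having one unplaced vertex
  -- fewer.
  have hw : ∀ g : children T r s ↪ A, weight G T r K q u (extend f (children T r s) A g) t₀ ≤
      if (g ⟨_, hi⟩ : V) = x (i + 1) then q ^ m else 0 := by
    intro g
    unfold weight
    split_ifs with hc hg
    · have := unplacedCount_extend_add_one hT g hs.2.2 (hdeep t₀ ht₀) hiK hi
      rw [show unplacedCount T r K (extend f (children T r s) A g) t₀ = m by omega]
    · exfalso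
      have hext := extends_extend g hs.2.2
      obtain ⟨x', hx', hx0', hxf'⟩ := hc (hext.isSome (hplaced t₀ i hiK hi))
      obtain ⟨-, h⟩ := Compatible.index_unique hG hv hiK hiK (hsucc _ _ hi) (hsucc _ _ hi)
        hx hx' (hx0.trans hx0'.symm) hxf (fun j hj y hy => hxf' j hj y (hext _ _ hy))
      apply hg
      rw [h, hxf' i (by omega) _ (extend_of_mem g hi)]
    · exact zero_le
    · exact le_rfl
  have hw₀ : weight G T r K q u f t₀ = q * q ^ m := by
    rw [weight, if_pos (hcomp t₀ ht₀), hm, pow_succ']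
  calc _ ≤ ∑ g : children T r s ↪ A, (Fintype.card (children T r s ↪ A) : ℝ≥0∞)⁻¹ *
          (if (g ⟨_, hi⟩ : V) = x (i + 1) then q ^ m else 0) *
            ∏ t ∈ S.erase t₀, weight G T r K q u f t := by
        refine Finset.sum_le_sum fun g _ => ?_
        rw [← Finset.mul_prod_erase S _ ht₀, mul_assoc]
        gcongr with t ht
        · exact hw g
        · exact weight_extend_le g hs.2.2 (hother t ht)
    _ ≤ (q * q ^ m) * ∏ t ∈ S.erase t₀, weight G T r K q u f t := by
        rw [← Finset.sum_mul]
        gcongr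
        exact (sum_embedding_ite_le _ _ _).trans (by gcongr)
    _ = _ := by rw [← hw₀, Finset.mul_prod_erase S _ ht₀]

end Weight


/-! ### Counting the vertices where an overload can occur. -/

section Candidates

variable {V W : Type*} {G : SimpleGraph V} {d : ℕ} {T : SimpleGraph W} {r : W}

open Classical in
/-- The vertices that can be reached from `v` in exactly `j` moves. -/
noncomputable def reach (N : OutNeighbourhoods G d) : ℕ → V → Finset V
  | 0, v => {v}
  | j + 1, v => (N.nbr v).biUnion (reach N j)

theorem card_reach_le (N : OutNeighbourhoods G d) (j : ℕ) (v : V) :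
    (reach N j v).card ≤ d ^ j := by
  classical
  induction j generalizing v with
  | zero => simp [reach]
  | succ j ih =>
    have h := Finset.card_biUnion_le_card_mul (N.nbr v) (reach N j) _ fun u _ => ih u
    rw [N.card_nbr v] at h
    rw [reach, pow_succ']
    exact h

theorem Valid.mem_reach {N : OutNeighbourhoods G d} {f : W → Option V} (hT : T.IsTree)
    (hf : Valid T r N f) {t : W} {x : V} (hx : f t = some x) {i : ℕ} (hi : i ≤ T.dist r t) {u : V}
    (hu : f ((TreeEmbedding.parent T r)^[i] t) = some u) : x ∈ reach N i u := by
  classical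
  induction i generalizing u with
  | zero =>
    have : x = u := Option.some.inj (hx.symm.trans hu)
    simp [reach, this]
  | succ i ih =>
    obtain ⟨w, hw⟩ := Option.isSome_iff_exists.1 (hf.iterate_parent (c := t) (by simp [hx]) i)
    rw [Function.iterate_succ_apply'] at hu
    rw [reach, Finset.mem_biUnion]
    exact ⟨w, hf.edge _ (iterate_parent_ne_root hT (by omega)) _ _ hw hu, ih (by omega) hw⟩

open Classical in
/-- A common neighbour of `y₁` and `y₂`, if there is one. -/
noncomputable def commonNeighbour (G : SimpleGraph V) (y₁ y₂ : V) : V :=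
  if h : ∃ v, G.Adj v y₁ ∧ G.Adj v y₂ then h.choose else y₁

/-- Two common neighbours would give two different paths of length `2` from `y₁` to `y₂`; this is
excluded as soon as `k` is at least `2`. -/
theorem commonNeighbour_eq {k : ℕ} (hk : 2 ≤ k) (hG : ((2 * k + 1 : ℕ) : ℕ∞) ≤ G.egirth)
    {v y₁ y₂ : V} (hne : y₁ ≠ y₂) (h₁ : G.Adj v y₁) (h₂ : G.Adj v y₂) :
    commonNeighbour G y₁ y₂ = v := by
  have h : ∃ v, G.Adj v y₁ ∧ G.Adj v y₂ := ⟨v, h₁, h₂⟩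
  rw [commonNeighbour, dif_pos h]
  obtain ⟨h₁', h₂'⟩ := h.choose_spec
  set w := h.choose
  let p : V → ℕ → V := fun a i => match i with
    | 0 => y₁
    | 1 => a
    | _ => y₂
  have hp : ∀ a, G.Adj a y₁ → G.Adj a y₂ → IsPathSeq G (p a) 2 := by
    intro a ha₁ ha₂
    refine ⟨fun i hi => ?_, fun i hi j hj hij => ?_⟩
    · interval_cases i
      · exact ha₁.symm
      · exact ha₂
    · have e₁ := ha₁.ne
      have e₂ := ha₂.ne
      interval_cases i <;> interval_cases j <;> simp_all [p]
  exact ((hp w h₁' h₂').unique hG (hp v h₁ h₂) hk hk rfl rfl).2 1 (by omega)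

open Classical in
/-- A set which contains every vertex that has one chosen neighbour in `K`-step reach of `u₁` and
another one in `K`-step reach of `u₂`. -/
noncomputable def candidates (N : OutNeighbourhoods G d) (K : ℕ) (u₁ u₂ : V) : Finset V :=
  (reach N K u₁ ×ˢ reach N K u₂).image fun y => commonNeighbour G y.1 y.2

theorem card_candidates_le (N : OutNeighbourhoods G d) (K : ℕ) (u₁ u₂ : V) :
    (candidates N K u₁ u₂).card ≤ d ^ (2 * K) := by
  classical
  refine Finset.card_image_le.trans ?_
  rw [Finset.card_product, two_mul, pow_add]
  exact Nat.mul_le_mul (card_reach_le N K u₁) (card_reach_le N K u₂)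

end Candidates

/-! ### Comparing the times at which tree vertices were placed. -/

section Stamp

variable {V W : Type*}

/-- The number of placements in the history `H` in which `x` is not placed. -/
def stamp (H : List (W → Option V)) (x : W) : ℕ := H.countP fun g => (g x).isNone

theorem stamp_cons_of_isSome {f : W → Option V} {x : W} (h : (f x).isSome)
    (H : List (W → Option V)) : stamp (f :: H) x = stamp H x := by
  rw [stamp, List.countP_cons_of_neg, stamp]
  simpa [Option.isSome_iff_ne_none] using h

theorem stamp_cons_of_eq_none {f : W → Option V} {x : W} (h : f x = none)
    (H : List (W → Option V)) : stamp (f :: H) x = stamp H x + 1 := by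
  rw [stamp, List.countP_cons_of_pos, stamp]
  simp [h]

theorem stamp_le_length (H : List (W → Option V)) (x : W) : stamp H x ≤ H.length :=
  List.countP_le_length

theorem stamp_eq_length {f : W → Option V} {x : W} (h : f x = none) {H : List (W → Option V)}
    (hH : ∀ g ∈ H, Extends g f) : stamp H x = H.length := by
  rw [stamp, List.countP_eq_length]
  intro g hg
  simp [(hH g hg).eq_none h]

open Classical in
/-- The vertices of depth at least `K` whose `K`-th ancestor was placed no earlier than `b₁` and
`b₂`. -/
noncomputable def fresh [Fintype W] (T : SimpleGraph W) (r : W) (K : ℕ) (H : List (W → Option V))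
    (b₁ b₂ : W) : Finset W :=
  Finset.univ.filter fun t => K ≤ T.dist r t ∧ stamp H b₁ ≤ stamp H ((parent T r)^[K] t) ∧
    stamp H b₂ ≤ stamp H ((parent T r)^[K] t)

/-- The stamp of a placed vertex is frozen, while that of an unplaced one equals the length of the
history and so exceeds or equals every other stamp. Hence the index set of the sums in the potential
is fixed once `b₁` and `b₂` are placed. -/
theorem fresh_cons [Fintype W] {T : SimpleGraph W} {r : W} {K : ℕ} {f f' : W → Option V}
    {past : List (W → Option V)} (hff : Extends f f') (hpast : ∀ g ∈ past, Extends g f) {b₁ b₂ : W}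
    (h₁ : (f b₁).isSome) (h₂ : (f b₂).isSome) :
    fresh T r K (f' :: f :: past) b₁ b₂ = fresh T r K (f :: past) b₁ b₂ := by
  unfold fresh
  apply Finset.filter_congr
  intro t _
  refine and_congr_right fun _ => ?_
  rw [stamp_cons_of_isSome (hff.isSome h₁), stamp_cons_of_isSome (hff.isSome h₂)]
  rcases Option.eq_none_or_eq_some (f' ((parent T r)^[K] t)) with h | ⟨x, h⟩
  · have h' := hff.eq_none h
    have e : stamp (f :: past) ((parent T r)^[K] t) = past.length + 1 := by
      rw [stamp_cons_of_eq_none h', stamp_eq_length h' hpast]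
    rw [stamp_cons_of_eq_none h, e]
    have e₁ := stamp_le_length (f :: past) b₁
    have e₂ := stamp_le_length (f :: past) b₂
    rw [List.length_cons] at e₁ e₂
    constructor <;> intro _ <;> constructor <;> omega
  · rw [stamp_cons_of_isSome (x := (parent T r)^[K] t) (by rw [h]; rfl)]

end Stamp

/-! ### The potential and its decrease on average. -/

section Potential

variable {V W : Type*} [Fintype W] {G : SimpleGraph V} {d : ℕ} {T : SimpleGraph W} {r : W}

open Classical in
/-- The sets of `m` fresh vertices with distinct `K`-th ancestors. -/
noncomputable def freshFamily (T : SimpleGraph W) (r : W) (K m : ℕ) (H : List (W → Option V))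
    (b₁ b₂ : W) : Finset (Finset W) :=
  ((fresh T r K H b₁ b₂).powersetCard m).filter fun S => Set.InjOn (parent T r)^[K] (S : Set W)

/-- The contribution of the pair `b₁`, `b₂` to the potential of the history `H` with current
placement `f`. -/
noncomputable def pairPotential (T : SimpleGraph W) (r : W) (N : OutNeighbourhoods G d) (K m M : ℕ)
    (q : ℝ≥0∞) (H : List (W → Option V)) (f : W → Option V) (b₁ b₂ : W) : ℝ≥0∞ :=
  match f b₁, f b₂ with
  | some u₁, some u₂ => ∑ v ∈ candidates N K u₁ u₂, ∑ S ∈ freshFamily T r K m H b₁ b₂,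
      ((M.choose m : ℝ≥0∞)⁻¹ * ∏ t ∈ S, weight G T r K q v f t)
  | _, _ => (d ^ (2 * K) : ℕ) * (((Fintype.card W).choose m : ℕ) *
      ((M.choose m : ℝ≥0∞)⁻¹ * (q ^ K) ^ m))

open Classical in
/-- The potential of a history whose current placement is its head. -/
noncomputable def potential (T : SimpleGraph W) (r : W) (N : OutNeighbourhoods G d) (K m M : ℕ)
    (q : ℝ≥0∞) : List (W → Option V) → ℝ≥0∞
  | [] => 0
  | f :: past => ∑ b ∈ (Finset.univ : Finset W).offDiag,
      pairPotential T r N K m M q (f :: past) f b.1 b.2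

variable {N : OutNeighbourhoods G d} {K m M : ℕ} {q : ℝ≥0∞}

theorem pairPotential_of_some {H : List (W → Option V)} {f : W → Option V} {b₁ b₂ : W} {u₁ u₂ : V}
    (h₁ : f b₁ = some u₁) (h₂ : f b₂ = some u₂) : pairPotential T r N K m M q H f b₁ b₂ =
      ∑ v ∈ candidates N K u₁ u₂, ∑ S ∈ freshFamily T r K m H b₁ b₂,
        ((M.choose m : ℝ≥0∞)⁻¹ * ∏ t ∈ S, weight G T r K q v f t) := by
  rw [pairPotential, h₁, h₂]

theorem pairPotential_of_not {H : List (W → Option V)} {f : W → Option V} {b₁ b₂ : W}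
    (h : ¬ ((f b₁).isSome ∧ (f b₂).isSome)) : pairPotential T r N K m M q H f b₁ b₂ =
      (d ^ (2 * K) : ℕ) * (((Fintype.card W).choose m : ℕ) *
        ((M.choose m : ℝ≥0∞)⁻¹ * (q ^ K) ^ m)) := by
  rw [pairPotential]
  split
  · simp_all
  · rfl

theorem card_freshFamily_le (H : List (W → Option V)) (b₁ b₂ : W) :
    (freshFamily T r K m H b₁ b₂).card ≤ (Fintype.card W).choose m := by
  classical
  refine (Finset.card_filter_le _ _).trans ?_
  rw [Finset.card_powersetCard]
  exact Nat.choose_le_choose m (Finset.card_le_univ _)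

section Step

variable {f : W → Option V} {past : List (W → Option V)} {s : W} {v : V}

/-- The round may place the `K`-th ancestor itself, but nothing below it on the branch: a child of
`s` there would make the `K`-th ancestor an ancestor of the placed vertex `s`, or `s` itself. -/
theorem unplacedCount_extend_of_eq_none (hT : T.IsTree) (hf : Valid T r N f)
    (hs : Ready T r f s) {A : Finset V} (g : children T r s ↪ A) {t : W}
    (ht : f ((parent T r)^[K] t) = none) :
    unplacedCount T r K (extend f (children T r s) A g) t = K := by
  classical
  unfold unplacedCount
  rw [Finset.filter_true_of_mem, Finset.card_range]
  intro i hi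
  have hi := Finset.mem_range.1 hi
  rw [extend_of_notMem]
  · exact hf.iterate_parent_eq_none hi.le ht
  · intro hmem
    have h := ((mem_children hT).1 hmem).2
    have := hf.iterate_parent hs.1 (K - (i + 1))
    rw [← h, ← Function.iterate_succ_apply' (parent T r), ← Function.iterate_add_apply,
      Nat.succ_eq_add_one, Nat.sub_add_cancel (by omega), ht] at this
    simp at this

/-- The right side is the value used before both vertices of the pair are placed. It multiplies the
bounds for the number of candidates, the number of sets and the product of weights; the last is
valid because every fresh branch still lacks all its `K` counted vertices when the pair is
completed. -/
theorem pairPotential_extend_le_of_not (hT : T.IsTree) (hf : Valid T r N f)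
    (hpast : ∀ g ∈ past, Extends g f) (hs : Ready T r f s) {A : Finset V}
    (g : children T r s ↪ A) {b₁ b₂ : W} (h : ¬ ((f b₁).isSome ∧ (f b₂).isSome)) :
    pairPotential T r N K m M q (extend f (children T r s) A g :: f :: past)
        (extend f (children T r s) A g) b₁ b₂ ≤
      (d ^ (2 * K) : ℕ) * (((Fintype.card W).choose m : ℕ) *
        ((M.choose m : ℝ≥0∞)⁻¹ * (q ^ K) ^ m)) := by
  classical
  have hext := extends_extend g hs.2.2
  set f' := extend f (children T r s) A g with hf'
  by_cases h' : (f' b₁).isSome ∧ (f' b₂).isSome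
  swap
  · rw [pairPotential_of_not h']
  obtain ⟨u₁, hu₁⟩ := Option.isSome_iff_exists.1 h'.1
  obtain ⟨u₂, hu₂⟩ := Option.isSome_iff_exists.1 h'.2
  -- One of `b₁`, `b₂` was unplaced in `f` and so has the largest possible stamp; a `K`-th ancestor
  -- already placed in `f` would have a smaller one.
  have hfresh : ∀ t ∈ fresh T r K (f' :: f :: past) b₁ b₂, f ((parent T r)^[K] t) = none := by
    intro t ht
    by_contra hne
    have hsome := Option.isSome_iff_ne_none.2 hne
    rw [fresh, Finset.mem_filter] at ht
    rw [stamp_cons_of_isSome (hext.isSome hsome), stamp_cons_of_isSome h'.1,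
      stamp_cons_of_isSome h'.2, stamp_cons_of_isSome hsome] at ht
    have hle := stamp_le_length past ((parent T r)^[K] t)
    rcases not_and_or.1 h with hb | hb
    · have hb : f b₁ = none := by simpa using hb
      have := ht.2.2.1
      rw [stamp_cons_of_eq_none hb, stamp_eq_length hb hpast] at this
      omega
    · have hb : f b₂ = none := by simpa using hb
      have := ht.2.2.2
      rw [stamp_cons_of_eq_none hb, stamp_eq_length hb hpast] at this
      omega
  have hweight : ∀ v, ∀ t ∈ fresh T r K (f' :: f :: past) b₁ b₂,
      weight G T r K q v f' t ≤ q ^ K := by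
    intro v t ht
    unfold weight
    split_ifs
    · rw [hf', unplacedCount_extend_of_eq_none hT hf hs g (hfresh t ht)]
    · exact zero_le
  rw [pairPotential_of_some hu₁ hu₂]
  calc _ ≤ ∑ v ∈ candidates N K u₁ u₂, ∑ S ∈ freshFamily T r K m (f' :: f :: past) b₁ b₂,
        ((M.choose m : ℝ≥0∞)⁻¹ * (q ^ K) ^ m) := by
        refine Finset.sum_le_sum fun v _ => Finset.sum_le_sum fun S hS => ?_
        gcongr
        rw [freshFamily, Finset.mem_filter, Finset.mem_powersetCard] at hS
        rw [← hS.1.2, ← Finset.prod_const]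
        exact Finset.prod_le_prod' fun t ht => hweight v t (hS.1.1 ht)
    _ ≤ _ := by
        rw [Finset.sum_const, Finset.sum_const, nsmul_eq_mul, nsmul_eq_mul]
        gcongr
        · exact card_candidates_le N K u₁ u₂
        · exact card_freshFamily_le _ _ _

open Classical in
theorem sum_pairPotential_le (hT : T.IsTree) (hG : ((2 * (K + 1) + 1 : ℕ) : ℕ∞) ≤ G.egirth)
    (hf : Valid T r N f) (hpast : ∀ g ∈ past, Extends g f) (hs : Ready T r f s)
    (hv : f s = some v) {A : Finset V}
    (hq : (A.card : ℝ≥0∞)⁻¹ ≤ q) (b₁ b₂ : W) :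
    ∑ g : children T r s ↪ A, (Fintype.card (children T r s ↪ A) : ℝ≥0∞)⁻¹ *
        pairPotential T r N K m M q (extend f (children T r s) A g :: f :: past)
          (extend f (children T r s) A g) b₁ b₂ ≤
      pairPotential T r N K m M q (f :: past) f b₁ b₂ := by
  by_cases h : (f b₁).isSome ∧ (f b₂).isSome
  swap
  · rw [pairPotential_of_not h]
    refine (Finset.sum_le_sum fun g _ => mul_le_mul_right
      (pairPotential_extend_le_of_not hT hf hpast hs g h) _).trans ?_
    rw [Finset.sum_const, Finset.card_univ, nsmul_eq_mul, ← mul_assoc]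
    exact mul_le_of_le_one_left zero_le (ENNReal.mul_inv_le_one _)
  obtain ⟨u₁, hu₁⟩ := Option.isSome_iff_exists.1 h.1
  obtain ⟨u₂, hu₂⟩ := Option.isSome_iff_exists.1 h.2
  rw [pairPotential_of_some hu₁ hu₂]
  have hfam : ∀ g : children T r s ↪ A,
      freshFamily T r K m (extend f (children T r s) A g :: f :: past) b₁ b₂ =
        freshFamily T r K m (f :: past) b₁ b₂ := by
    intro g
    rw [freshFamily, freshFamily, fresh_cons (extends_extend g hs.2.2) hpast h.1 h.2]
  calc _ = ∑ u ∈ candidates N K u₁ u₂, ∑ S ∈ freshFamily T r K m (f :: past) b₁ b₂,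
        ((M.choose m : ℝ≥0∞)⁻¹ * ∑ g : children T r s ↪ A,
          (Fintype.card (children T r s ↪ A) : ℝ≥0∞)⁻¹ *
            ∏ t ∈ S, weight G T r K q u (extend f (children T r s) A g) t) := by
        simp_rw [fun g => pairPotential_of_some (T := T) (r := r) (N := N) (K := K) (m := m) (M := M)
          (q := q) (H := extend f (children T r s) A g :: f :: past)
          (extends_extend g hs.2.2 _ _ hu₁) (extends_extend g hs.2.2 _ _ hu₂), hfam,
          Finset.mul_sum]
        rw [Finset.sum_comm]
        refine Finset.sum_congr rfl fun u _ => ?_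
        rw [Finset.sum_comm]
        refine Finset.sum_congr rfl fun S _ => Finset.sum_congr rfl fun g _ => ?_
        rw [mul_left_comm]
    _ ≤ _ := by
        refine Finset.sum_le_sum fun u _ => Finset.sum_le_sum fun S hS => ?_
        rw [freshFamily, Finset.mem_filter, Finset.mem_powersetCard] at hS
        gcongr
        refine sum_prod_weight_le hT hG hf hs hv hq S (fun t ht => ?_) hS.2
        have := hS.1.1 ht
        rw [fresh, Finset.mem_filter] at this
        exact this.2.1

open Classical in
theorem sum_potential_le (hT : T.IsTree) (hG : ((2 * (K + 1) + 1 : ℕ) : ℕ∞) ≤ G.egirth)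
    (hf : Valid T r N f) (hpast : ∀ g ∈ past, Extends g f) (hs : Ready T r f s)
    (hv : f s = some v) {A : Finset V}
    (hq : (A.card : ℝ≥0∞)⁻¹ ≤ q) :
    ∑ g : children T r s ↪ A, (Fintype.card (children T r s ↪ A) : ℝ≥0∞)⁻¹ *
        potential T r N K m M q (extend f (children T r s) A g :: f :: past) ≤
      potential T r N K m M q (f :: past) := by
  simp_rw [potential, Finset.mul_sum]
  rw [Finset.sum_comm]
  exact Finset.sum_le_sum fun b _ => sum_pairPotential_le hT hG hf hpast hs hv hq b.1 b.2

end Step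

/-- With only the root placed, no pair of distinct vertices is complete, so every pair contributes
its a priori value. -/
theorem potential_placeRoot_le (v : V) : potential T r N K m M q [placeRoot r v] ≤
    (Fintype.card W : ℝ≥0∞) ^ 2 * ((d ^ (2 * K) : ℕ) * (((Fintype.card W).choose m : ℕ) *
        ((M.choose m : ℝ≥0∞)⁻¹ * (q ^ K) ^ m))) := by
  classical
  rw [potential]
  have h : ∀ b ∈ (Finset.univ : Finset W).offDiag,
      pairPotential T r N K m M q [placeRoot r v] (placeRoot r v) b.1 b.2 =
        (d ^ (2 * K) : ℕ) * (((Fintype.card W).choose m : ℕ) *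
        ((M.choose m : ℝ≥0∞)⁻¹ * (q ^ K) ^ m)) := by
    intro b hb
    apply pairPotential_of_not
    intro hsome
    apply (Finset.mem_offDiag.1 hb).2.2
    have key : ∀ c, (placeRoot r v c).isSome → c = r := by
      intro c hc
      by_contra hne
      simp [placeRoot, hne] at hc
    rw [key _ hsome.1, key _ hsome.2]
  rw [Finset.sum_congr rfl h, Finset.sum_const, nsmul_eq_mul]
  gcongr
  rw [Finset.offDiag_card, Finset.card_univ, sq]
  exact_mod_cast Nat.sub_le _ _

end Potential


/-! ### An overload forces the potential to be at least one. -/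

section Overload

variable {V W : Type*} {G : SimpleGraph V} {d : ℕ} {T : SimpleGraph W} {r : W}
  {N : OutNeighbourhoods G d} {f : W → Option V} {v : V}

/-- The vertex `v`, followed by the positions of `t` and of its ancestors. -/
noncomputable def branchSeq (T : SimpleGraph W) (r : W) (f : W → Option V) (v : V) (t : W) : ℕ → V
  | 0 => v
  | i + 1 => (f ((parent T r)^[i] t)).getD v

theorem branchSeq_succ {t : W} {i : ℕ} {y : V} (h : f ((parent T r)^[i] t) = some y) :
    branchSeq T r f v t (i + 1) = y := by
  simp [branchSeq, h]

/-- The branch cannot return to `v`: it would then pass through `s`, either at `t` itself, making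
`v` its own neighbour, or through a placed child of `s`, although `s` is ready. -/
theorem isPathSeq_branchSeq [Fintype W] (hT : T.IsTree) (hf : Valid T r N f) {s : W}
    (hs : Ready T r f s) (hv : f s = some v) {t : W} {x : V} (hx : f t = some x)
    (hxv : x ∈ N.nbr v) {j : ℕ} (hj : j ≤ T.dist r t) :
    IsPathSeq G (branchSeq T r f v t) (j + 1) := by
  have hpos : ∀ i, f ((parent T r)^[i] t) = some (branchSeq T r f v t (i + 1)) := by
    intro i
    obtain ⟨y, hy⟩ := Option.isSome_iff_exists.1 (hf.iterate_parent (c := t) (by simp [hx]) i)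
    rw [hy, branchSeq_succ hy]
  have hne : ∀ i ≤ j, branchSeq T r f v t (i + 1) ≠ v := by
    intro i hi h
    have h' := hpos i
    rw [h] at h'
    have hst := hf.inj _ _ _ h' hv
    rcases i with _ | i
    · rw [Function.iterate_zero_apply] at h'
      rw [h'] at hx
      obtain rfl := Option.some.inj hx
      exact G.loopless.irrefl _ (N.adj _ _ hxv)
    · rw [Function.iterate_succ_apply'] at hst
      have := hs.2.2 _ ((mem_children hT).2 ⟨iterate_parent_ne_root hT (by omega), hst⟩)
      rw [hpos i] at this
      simp at this
  refine ⟨fun i hi => ?_, fun i hi i' hi' h => ?_⟩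
  · rcases i with _ | i
    · have h0 := hpos 0
      rw [Function.iterate_zero_apply, hx] at h0
      rw [← Option.some.inj h0]
      exact N.adj _ _ hxv
    · have h1 := hpos (i + 1)
      rw [Function.iterate_succ_apply'] at h1
      exact (N.adj _ _ (hf.edge _ (iterate_parent_ne_root hT (by omega)) _ _ (hpos i) h1)).symm
  · rcases i with _ | i <;> rcases i' with _ | i'
    · rfl
    · exact absurd h.symm (hne i' (by omega))
    · exact absurd h (hne i (by omega))
    · have h1 := hpos i
      rw [h] at h1
      rw [iterate_parent_injective hT (by omega) (by omega) (hf.inj _ _ _ h1 (hpos i'))]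

/-- Branches that meet give two short paths from `v` with the same end, so their first steps, the
positions of `t` and `t'`, agree. -/
theorem eq_of_iterate_parent_eq [Fintype W] {K : ℕ} (hT : T.IsTree)
    (hG : ((2 * (K + 1) + 1 : ℕ) : ℕ∞) ≤ G.egirth) (hf : Valid T r N f) {s : W}
    (hs : Ready T r f s) (hv : f s = some v) {t t' : W} {x x' : V} (hx : f t = some x)
    (hx' : f t' = some x') (hxv : x ∈ N.nbr v) (hxv' : x' ∈ N.nbr v) {j j' : ℕ}
    (hj : j ≤ T.dist r t) (hj' : j' ≤ T.dist r t') (hjK : j ≤ K) (hjK' : j' ≤ K)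
    (h : (parent T r)^[j] t = (parent T r)^[j'] t') : t = t' := by
  obtain ⟨-, he⟩ := (isPathSeq_branchSeq hT hf hs hv hx hxv hj).unique hG
    (isPathSeq_branchSeq hT hf hs hv hx' hxv' hj') (by omega) (by omega) rfl
    (by rw [branchSeq, branchSeq, h])
  have h1 := he 1 (by omega)
  rw [branchSeq_succ (i := 0) hx, branchSeq_succ (i := 0) hx'] at h1
  exact hf.inj _ _ _ hx (h1 ▸ hx')

theorem weight_eq_one [Fintype W] {K : ℕ} {q : ℝ≥0∞} (hT : T.IsTree) (hf : Valid T r N f) {s : W}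
    (hs : Ready T r f s) (hv : f s = some v) {t : W} {x : V} (hx : f t = some x)
    (hxv : x ∈ N.nbr v) (ht : K ≤ T.dist r t) : weight G T r K q v f t = 1 := by
  classical
  rw [weight, if_pos, unplacedCount, Finset.filter_false_of_mem, Finset.card_empty, pow_zero]
  · intro i _ h
    have := hf.iterate_parent (c := t) (by simp [hx]) i
    simp [h] at this
  · exact fun _ => ⟨_, isPathSeq_branchSeq hT hf hs hv hx hxv ht, rfl,
      fun i _ y hy => branchSeq_succ hy⟩

open Classical in
/-- The vertices of depth at least `K` that are placed in `nbr v`. -/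
noncomputable def deepPlaced [Fintype W] (T : SimpleGraph W) (r : W) (N : OutNeighbourhoods G d)
    (f : W → Option V) (K : ℕ) (v : V) : Finset W :=
  Finset.univ.filter fun t => K ≤ T.dist r t ∧ ∃ x ∈ N.nbr v, f t = some x

/-- The branches of all vertices of depth below `K` lead back to the root, so at most one such
vertex lies next to `v`. -/
theorem card_occupied_le [Fintype W] {K : ℕ} (hT : T.IsTree)
    (hG : ((2 * (K + 1) + 1 : ℕ) : ℕ∞) ≤ G.egirth) (hf : Valid T r N f) {s : W}
    (hs : Ready T r f s) (hv : f s = some v) :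
    (occupied N f v).card ≤ (deepPlaced T r N f K v).card + 1 := by
  classical
  set R : Finset W := Finset.univ.filter fun t => T.dist r t < K ∧ ∃ x ∈ N.nbr v, f t = some x
  have hR : R.card ≤ 1 := by
    rw [Finset.card_le_one]
    intro t ht t' ht'
    obtain ⟨-, h, x, hxv, hx⟩ := Finset.mem_filter.1 ht
    obtain ⟨-, h', x', hxv', hx'⟩ := Finset.mem_filter.1 ht'
    refine eq_of_iterate_parent_eq hT hG hf hs hv hx hx' hxv hxv' le_rfl le_rfl h.le h'.le ?_
    rw [iterate_parent_eq_root hT le_rfl, iterate_parent_eq_root hT le_rfl]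
  have hsub : occupied N f v ⊆
      (deepPlaced T r N f K v ∪ R).image fun t => (f t).getD v := by
    intro x hx
    simp only [occupied, Finset.mem_filter] at hx
    obtain ⟨hxv, t, ht⟩ := hx
    refine Finset.mem_image.2 ⟨t, ?_, by simp [ht]⟩
    rw [Finset.mem_union, deepPlaced, Finset.mem_filter, Finset.mem_filter]
    rcases lt_or_ge (T.dist r t) K with h | h
    · exact Or.inr ⟨Finset.mem_univ _, h, x, hxv, ht⟩
    · exact Or.inl ⟨Finset.mem_univ _, h, x, hxv, ht⟩
  calc _ ≤ _ := Finset.card_le_card hsub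
    _ ≤ _ := Finset.card_image_le
    _ ≤ _ := Finset.card_union_le _ _
    _ ≤ _ := by omega

/-- If many chosen neighbours of the position of a ready vertex are occupied, then the potential is
at least `1`. -/
theorem one_le_potential [Fintype W] {K m M : ℕ} {q : ℝ≥0∞} (hK : 1 ≤ K) (hm : m ≤ M)
    (hT : T.IsTree) (hG : ((2 * (K + 1) + 1 : ℕ) : ℕ∞) ≤ G.egirth) (hf : Valid T r N f) {s : W}
    (hs : Ready T r f s) (hv : f s = some v) (past : List (W → Option V))
    (hocc : M + 3 ≤ (occupied N f v).card) :
    1 ≤ potential T r N K m M q (f :: past) := by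
  classical
  set Q := deepPlaced T r N f K v with hQdef
  have hcard : M + 2 ≤ Q.card := by
    have := card_occupied_le (K := K) hT hG hf hs hv
    rw [← hQdef] at this
    omega
  have hQ : ∀ t ∈ Q, K ≤ T.dist r t ∧ ∃ x ∈ N.nbr v, f t = some x := fun t ht =>
    (Finset.mem_filter.1 ht).2
  have hinj : Set.InjOn (parent T r)^[K] (Q : Set W) := by
    intro t ht t' ht' h
    obtain ⟨hd, x, hxv, hx⟩ := hQ t ht
    obtain ⟨hd', x', hxv', hx'⟩ := hQ t' ht'
    exact eq_of_iterate_parent_eq hT hG hf hs hv hx hx' hxv hxv' hd hd' le_rfl le_rfl h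
  set H := f :: past
  -- The two vertices with the earliest `K`-th ancestors serve to locate `v`. The remaining `M` or
  -- more are fresh relative to them; with the possible shallow vertex this accounts for `M + 3`.
  obtain ⟨t₁, ht₁, hmin₁⟩ := Q.exists_min_image (fun t => stamp H ((parent T r)^[K] t))
    (Finset.card_pos.1 (by omega))
  have hc₁ := Finset.card_erase_of_mem ht₁
  obtain ⟨t₂, ht₂, hmin₂⟩ := (Q.erase t₁).exists_min_image
    (fun t => stamp H ((parent T r)^[K] t)) (Finset.card_pos.1 (by omega))
  have hc₂ := Finset.card_erase_of_mem ht₂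
  obtain ⟨hne, ht₂Q⟩ := Finset.mem_erase.1 ht₂
  set Q' := (Q.erase t₁).erase t₂
  have hQ' : M ≤ Q'.card := by omega
  have hQQ : Q' ⊆ Q := (Finset.erase_subset _ _).trans (Finset.erase_subset _ _)
  set b₁ := (parent T r)^[K] t₁ with hb₁
  set b₂ := (parent T r)^[K] t₂ with hb₂
  have hb : b₁ ≠ b₂ := fun h => hne (hinj ht₂Q ht₁ h.symm)
  obtain ⟨hd₁, x₁, hxv₁, hx₁⟩ := hQ t₁ ht₁
  obtain ⟨hd₂, x₂, hxv₂, hx₂⟩ := hQ t₂ ht₂Q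
  obtain ⟨u₁, hu₁⟩ := Option.isSome_iff_exists.1 (hf.iterate_parent (c := t₁) (by simp [hx₁]) K)
  obtain ⟨u₂, hu₂⟩ := Option.isSome_iff_exists.1 (hf.iterate_parent (c := t₂) (by simp [hx₂]) K)
  have hcand : v ∈ candidates N K u₁ u₂ := by
    refine Finset.mem_image.2 ⟨(x₁, x₂), Finset.mem_product.2
      ⟨hf.mem_reach hT hx₁ hd₁ hu₁, hf.mem_reach hT hx₂ hd₂ hu₂⟩, ?_⟩
    refine commonNeighbour_eq (by omega) hG ?_ (N.adj _ _ hxv₁) (N.adj _ _ hxv₂)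
    intro (h : x₁ = x₂)
    exact hne (hf.inj _ _ _ hx₂ (h ▸ hx₁))
  have hfam : Q'.powersetCard m ⊆ freshFamily T r K m H b₁ b₂ := by
    intro S hS
    obtain ⟨hSQ, hSm⟩ := Finset.mem_powersetCard.1 hS
    rw [freshFamily, Finset.mem_filter, Finset.mem_powersetCard]
    refine ⟨⟨fun t ht => ?_, hSm⟩, hinj.mono (Finset.coe_subset.2 (hSQ.trans hQQ))⟩
    rw [fresh, Finset.mem_filter]
    exact ⟨Finset.mem_univ _, (hQ t (hQQ (hSQ ht))).1, hmin₁ t (hQQ (hSQ ht)),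
      hmin₂ t (Finset.mem_of_mem_erase (hSQ ht))⟩
  have hone : ∀ S ∈ Q'.powersetCard m, ∏ t ∈ S, weight G T r K q v f t = 1 := by
    intro S hS
    refine Finset.prod_eq_one fun t ht => ?_
    obtain ⟨hd, x, hxv, hx⟩ := hQ t (hQQ ((Finset.mem_powersetCard.1 hS).1 ht))
    exact weight_eq_one hT hf hs hv hx hxv hd
  calc (1 : ℝ≥0∞) = (M.choose m : ℝ≥0∞) * (M.choose m : ℝ≥0∞)⁻¹ := by
        rw [ENNReal.mul_inv_cancel]
        · exact_mod_cast (Nat.choose_pos hm).ne'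
        · exact ENNReal.natCast_ne_top _
    _ ≤ ((Q'.powersetCard m).card : ℝ≥0∞) * (M.choose m : ℝ≥0∞)⁻¹ := by
        gcongr
        rw [Finset.card_powersetCard]
        exact Nat.choose_le_choose m hQ'
    _ = ∑ S ∈ Q'.powersetCard m,
          ((M.choose m : ℝ≥0∞)⁻¹ * ∏ t ∈ S, weight G T r K q v f t) := by
        rw [Finset.sum_congr rfl fun S hS => by rw [hone S hS, mul_one], Finset.sum_const,
          nsmul_eq_mul]
    _ ≤ ∑ S ∈ freshFamily T r K m H b₁ b₂,
          ((M.choose m : ℝ≥0∞)⁻¹ * ∏ t ∈ S, weight G T r K q v f t) :=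
        Finset.sum_le_sum_of_subset hfam
    _ ≤ pairPotential T r N K m M q H f b₁ b₂ := by
        rw [pairPotential_of_some hu₁ hu₂]
        exact Finset.single_le_sum (f := fun v => ∑ S ∈ freshFamily T r K m H b₁ b₂,
          ((M.choose m : ℝ≥0∞)⁻¹ * ∏ t ∈ S, weight G T r K q v f t)) (fun _ _ => zero_le) hcand
    _ ≤ potential T r N K m M q H := by
        rw [potential]
        exact Finset.single_le_sum (f := fun b : W × W => pairPotential T r N K m M q H f b.1 b.2)
          (fun _ _ => zero_le) (Finset.mem_offDiag.2 ⟨Finset.mem_univ _, Finset.mem_univ _, hb⟩ :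
            (b₁, b₂) ∈ _)

end Overload


/-! ### Numerical bounds. -/

section Estimates

theorem choose_mul_pow_le {n m M : ℕ} (hm : m < M) :
    n.choose m * (M - m) ^ m ≤ n ^ m * M.choose m := by
  have h1 : n.choose m * m.factorial ≤ n ^ m := by
    rw [mul_comm, ← Nat.descFactorial_eq_factorial_mul_choose]
    exact Nat.descFactorial_le_pow n m
  have h2 : (M - m) ^ m ≤ M.choose m * m.factorial := by
    rw [mul_comm (M.choose m), ← Nat.descFactorial_eq_factorial_mul_choose]
    exact (Nat.pow_le_pow_left (by omega) m).trans (Nat.pow_sub_le_descFactorial M m)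
  refine Nat.le_of_mul_le_mul_right ?_ m.factorial_pos
  calc n.choose m * (M - m) ^ m * m.factorial = n.choose m * m.factorial * (M - m) ^ m := by ring
    _ ≤ n ^ m * (M.choose m * m.factorial) := Nat.mul_le_mul h1 h2
    _ = _ := by ring

theorem choose_mul_pow_le_of_le {n m M : ℕ} (hm : m < M) {p c : ℝ} (hp : 0 ≤ p)
    (h : n * p ≤ c * (M - m)) : n.choose m * p ^ m ≤ c ^ m * M.choose m := by
  have hpos : (0 : ℝ) < M - m := by
    have : (m : ℝ) < M := by exact_mod_cast hm
    linarith
  refine le_of_mul_le_mul_right ?_ (pow_pos hpos m)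
  have h1 : (n.choose m : ℝ) * (M - m) ^ m ≤ n ^ m * M.choose m := by
    have := choose_mul_pow_le (n := n) hm
    have h' : ((n.choose m * (M - m) ^ m : ℕ) : ℝ) ≤ ((n ^ m * M.choose m : ℕ) : ℝ) := by
      exact_mod_cast this
    push_cast [Nat.cast_sub hm.le] at h'
    exact h'
  calc n.choose m * p ^ m * (M - m : ℝ) ^ m = (n.choose m * (M - m : ℝ) ^ m) * p ^ m := by ring
    _ ≤ (n ^ m * M.choose m) * p ^ m := by gcongr
    _ = (n * p) ^ m * M.choose m := by ring
    _ ≤ (c * (M - m)) ^ m * M.choose m := by gcongr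
    _ = _ := by rw [mul_pow]; ring

/-- A polynomial times a geometric sequence of ratio `(3 / 4) ^ (ε / 4)` tends to zero. Rounding the
exponent down costs a factor of at most `4 / 3`, whence the `3 / 16`. -/
theorem exists_degree_threshold (k : ℕ) {ε η : ℝ} (hε : 0 < ε) (hη : 0 < η) :
    ∃ d₀ : ℕ, ∀ d : ℕ, d₀ ≤ d → 68 ≤ ε * d ∧
      4 * (d : ℝ) ^ (4 * k) * (3 / 4 : ℝ) ^ ⌊ε * d / 4⌋₊ ≤ η := by
  set ρ : ℝ := (3 / 4 : ℝ) ^ (ε / 4) with hρ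
  have hρ0 : 0 ≤ ρ := Real.rpow_nonneg (by norm_num) _
  have hρ1 : ρ < 1 := Real.rpow_lt_one (by norm_num) (by norm_num) (by positivity)
  have hlim := tendsto_pow_const_mul_const_pow_of_abs_lt_one (4 * k)
    (show |ρ| < 1 by rwa [abs_of_nonneg hρ0])
  have h1 := hlim.eventually (ge_mem_nhds (show (0 : ℝ) < η * (3 / 16) by positivity))
  obtain ⟨d₁, hd₁⟩ := Filter.eventually_atTop.1 h1
  refine ⟨max d₁ ⌈68 / ε⌉₊, fun d hd => ⟨?_, ?_⟩⟩
  · have : 68 / ε ≤ d := (Nat.le_ceil _).trans (by exact_mod_cast (le_max_right _ _).trans hd)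
    rw [div_le_iff₀ hε] at this
    linarith
  · have h2 := hd₁ d ((le_max_left _ _).trans hd)
    have h3 : (3 / 4 : ℝ) ^ ⌊ε * d / 4⌋₊ ≤ (4 / 3) * ρ ^ d := by
      rw [← Real.rpow_natCast, hρ, ← Real.rpow_natCast _ d, ← Real.rpow_mul (by norm_num)]
      calc (3 / 4 : ℝ) ^ (⌊ε * d / 4⌋₊ : ℝ) ≤ (3 / 4 : ℝ) ^ (ε / 4 * d - 1) := by
            apply Real.rpow_le_rpow_of_exponent_ge (by norm_num) (by norm_num)
            have := Nat.lt_floor_add_one (ε * d / 4)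
            linarith
        _ = _ := by
            rw [Real.rpow_sub (by norm_num), Real.rpow_one]
            ring
    calc 4 * (d : ℝ) ^ (4 * k) * (3 / 4 : ℝ) ^ ⌊ε * d / 4⌋₊
        ≤ 4 * (d : ℝ) ^ (4 * k) * ((4 / 3) * ρ ^ d) := by gcongr
      _ = (16 / 3) * ((d : ℝ) ^ (4 * k) * ρ ^ d) := by ring
      _ ≤ _ := by linarith

/-- Bernoulli's inequality gives `(1 - ε) ^ K ≥ 1 - K * ε ≥ 1 / 2`; this is what the upper bound on
`ε` is for. -/
theorem mul_inv_pow_le {K d n : ℕ} {ε : ℝ} (hε : 0 < ε) (hεk : ε ≤ 1 / (2 * ((K + 1 : ℕ) : ℝ)))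
    (hd : 1 ≤ d) (hn : (n : ℝ) ≤ 1 / 4 * ε * d ^ (K + 1) + 1) :
    n * (((1 - ε) * d)⁻¹) ^ K ≤ ε * d / 2 + 2 := by
  have hK : (K : ℝ) * ε ≤ 1 / 2 := by
    rw [le_div_iff₀ (by positivity)] at hεk
    push_cast at hεk
    nlinarith
  have hε1 : ε ≤ 1 / 2 := hεk.trans <| by
    apply one_div_le_one_div_of_le (by norm_num)
    push_cast
    have : (0 : ℝ) ≤ K := K.cast_nonneg
    linarith
  have hd1 : (1 : ℝ) ≤ d := by exact_mod_cast hd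
  have hb : 1 / 2 ≤ (1 - ε) ^ K := by
    have := one_add_mul_le_pow (show (-2 : ℝ) ≤ -ε by linarith) K
    rw [← sub_eq_add_neg 1 ε] at this
    linarith
  have hdK : 1 ≤ (d : ℝ) ^ K := one_le_pow₀ hd1
  rw [inv_pow, mul_pow, ← div_eq_mul_inv, div_le_iff₀ (by positivity)]
  calc (n : ℝ) ≤ 1 / 4 * ε * d ^ (K + 1) + 1 := hn
    _ ≤ (ε * d / 2 + 2) * (1 / 2 * d ^ K) := by
        rw [pow_succ]
        nlinarith
    _ ≤ _ := by gcongr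

theorem inv_card_available_le {V W : Type*} {G : SimpleGraph V} {d : ℕ} {N : OutNeighbourhoods G d} {f : W → Option V} {v : V} {ε : ℝ}
    (hpos : 0 < (1 - ε) * d) (h : ((occupied N f v).card : ℝ) ≤ ε * d) :
    ((available N f v).card : ℝ≥0∞)⁻¹ ≤ ENNReal.ofReal ((1 - ε) * d)⁻¹ := by
  rw [ENNReal.ofReal_inv_of_pos hpos, ENNReal.inv_le_inv, ← ENNReal.ofReal_natCast]
  apply ENNReal.ofReal_le_ofReal
  have h1 : ((available N f v).card : ℝ) + (occupied N f v).card = d := by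
    exact_mod_cast card_available_add_card_occupied (N := N) f v
  linarith

end Estimates

/-! ### Assembling the bound. -/

section Success

variable {V W : Type*} [Fintype W] {G : SimpleGraph V} {d : ℕ} {T : SimpleGraph W} {r : W}

open Classical in
theorem one_sub_le_success [DecidableRel T.Adj] (hT : T.IsTree) (N : OutNeighbourhoods G d)
    (v₁ : V) {k : ℕ} (σ : SelectionRule V T r) {ε η : ℝ} (hη : 0 < η) (hε : 0 ≤ ε)
    (hΔ : (T.maxDegree : ℝ) ≤ d - 2 * ε * d - 2)
    (pot : List (W → Option V) → ℝ≥0∞)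
    (hroot : ∀ v, pot [placeRoot r v] ≤ ENNReal.ofReal η)
    (hstep : ∀ f past s v, Valid T r N f → (∀ g ∈ past, Extends g f) → Ready T r f s →
      f s = some v → ((occupied N f v).card : ℝ) ≤ ε * d →
      ∑ g : children T r s ↪ available N f v,
        (Fintype.card (children T r s ↪ available N f v) : ℝ≥0∞)⁻¹ *
          pot (extend f (children T r s) (available N f v) g :: f :: past) ≤ pot (f :: past))
    (hover : ∀ f past s v, Valid T r N f → (∀ g ∈ past, Extends g f) → Ready T r f s →
      f s = some v → ε * d < ((occupied N f v).card : ℝ) → 1 ≤ pot (f :: past)) :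
    ENNReal.ofReal (1 - η) ≤ (embedLaw T r N k v₁ σ).toOuterMeasure (Success G T) := by
  have hΔ' : ∀ s, ((children T r s).card : ℝ) ≤ d - ε * d := by
    intro s
    have h : ((children T r s).card : ℝ) ≤ T.maxDegree := by exact_mod_cast card_children_le s
    have : 0 ≤ ε * d := by positivity
    linarith
  rw [embedLaw, PMF.toOuterMeasure_bind_apply]
  calc ENNReal.ofReal (1 - η) = ∑' l, walkLaw N (k - 1) v₁ l * ENNReal.ofReal (1 - η) := by
        rw [ENNReal.tsum_mul_right, PMF.tsum_coe, one_mul]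
    _ ≤ _ := by
        refine ENNReal.tsum_le_tsum fun l => ?_
        gcongr
        have h := one_le_success_add_potential hT hΔ' (σ.pick l) (σ.pick_ready l) pot
          (fun f past s v h₁ h₂ h₃ h₄ h₅ _ => hstep f past s v h₁ h₂ h₃ h₄ h₅) hover
          (Fintype.card W) [] (placeRoot r (l.getLastD v₁)) (valid_placeRoot _) (by simp)
          (Finset.card_le_univ _)
        rw [ENNReal.ofReal_sub _ hη.le, ENNReal.ofReal_one, tsub_le_iff_right]
        refine h.trans ?_
        gcongr
        exact hroot _

theorem card_occupied_le_card (N : OutNeighbourhoods G d) (f : W → Option V) (v : V) :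
    (occupied N f v).card ≤ Fintype.card W := by
  classical
  refine (Finset.card_le_card (t := Finset.univ.image fun t => (f t).getD v) ?_).trans
    Finset.card_image_le
  intro x hx
  simp only [occupied, Finset.mem_filter] at hx
  obtain ⟨-, t, ht⟩ := hx
  exact Finset.mem_image.2 ⟨t, Finset.mem_univ _, by simp [ht]⟩

theorem initial_potential_le {K n d : ℕ} {ε η : ℝ} (hε : 0 < ε)
    (hεk : ε ≤ 1 / (2 * ((K + 1 : ℕ) : ℝ))) (hd : 68 ≤ ε * d)
    (hlim : 4 * (d : ℝ) ^ (4 * (K + 1)) * (3 / 4 : ℝ) ^ ⌊ε * d / 4⌋₊ ≤ η)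
    (hn : (n : ℝ) ≤ 1 / 4 * ε * d ^ (K + 1) + 1) {m M : ℕ} (hm : m = ⌊ε * d / 4⌋₊)
    (hM : M = ⌊ε * d⌋₊ - 2) :
    (n : ℝ≥0∞) ^ 2 * ((d ^ (2 * K) : ℕ) * ((n.choose m : ℕ) *
        ((M.choose m : ℝ≥0∞)⁻¹ * (ENNReal.ofReal ((1 - ε) * d)⁻¹ ^ K) ^ m))) ≤
      ENNReal.ofReal η := by
  have hε1 : ε ≤ 1 / 2 := hεk.trans <| by
    apply one_div_le_one_div_of_le (by norm_num)
    push_cast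
    have : (0 : ℝ) ≤ K := K.cast_nonneg
    linarith
  have hd1 : (1 : ℝ) ≤ d := by nlinarith
  have hpos : 0 < (1 - ε) * d := by nlinarith
  have hm' : (m : ℝ) ≤ ε * d / 4 := hm ▸ Nat.floor_le (by positivity)
  have hM' : ε * d - 3 ≤ M := by
    have h1 := Nat.lt_floor_add_one (ε * d)
    have h2 : ⌊ε * d⌋₊ ≤ M + 2 := by omega
    have h3 : (⌊ε * d⌋₊ : ℝ) ≤ M + 2 := by exact_mod_cast h2
    linarith
  have hmM : m < M := by
    have : (m : ℝ) < M := by linarith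
    exact_mod_cast this
  -- The requirement is `ε d / 2 + 2 ≤ (3 / 4) (M - m)`. As `M - m ≥ 3 ε d / 4 - 3`, it follows from
  -- `ε d ≥ 68`, the source of that constant.
  have hch := choose_mul_pow_le_of_le hmM (c := 3 / 4) (n := n)
    (p := (((1 - ε) * d)⁻¹) ^ K) (by positivity)
    ((mul_inv_pow_le hε hεk (by exact_mod_cast hd1) hn).trans (by linarith))
  have hC : (0 : ℝ) < M.choose m := by exact_mod_cast Nat.choose_pos hmM.le
  have hreal : (n : ℝ) ^ 2 * ((d ^ (2 * K) : ℕ) * ((n.choose m : ℕ) *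
      ((M.choose m : ℝ)⁻¹ * ((((1 - ε) * d)⁻¹) ^ K) ^ m))) ≤ η := by
    have h1 : (n.choose m : ℝ) * ((M.choose m : ℝ)⁻¹ * ((((1 - ε) * d)⁻¹) ^ K) ^ m) ≤
        (3 / 4) ^ m := by
      rw [mul_left_comm, inv_mul_le_iff₀ hC, mul_comm (M.choose m : ℝ)]
      exact hch
    have hdK : 1 ≤ (d : ℝ) ^ (K + 1) := one_le_pow₀ hd1
    have h2 : (n : ℝ) ≤ 2 * d ^ (K + 1) := by nlinarith
    calc _ ≤ (2 * (d : ℝ) ^ (K + 1)) ^ 2 * ((d : ℝ) ^ (2 * (K + 1)) * (3 / 4) ^ m) := by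
          push_cast
          gcongr
          omega
      _ = 4 * (d : ℝ) ^ (4 * (K + 1)) * (3 / 4 : ℝ) ^ m := by ring
      _ ≤ η := hm ▸ hlim
  refine le_trans (le_of_eq ?_) (ENNReal.ofReal_le_ofReal hreal)
  rw [ENNReal.ofReal_mul (by positivity), ENNReal.ofReal_mul (by positivity),
    ENNReal.ofReal_mul (by positivity), ENNReal.ofReal_mul (by positivity),
    ENNReal.ofReal_inv_of_pos hC, ENNReal.ofReal_pow (by positivity),
    ENNReal.ofReal_pow (by positivity), ENNReal.ofReal_pow (by positivity),
    ENNReal.ofReal_natCast, ENNReal.ofReal_natCast, ENNReal.ofReal_natCast, ENNReal.ofReal_natCast]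

theorem embedLaw_success [DecidableRel T.Adj] {k : ℕ} (hk : 1 ≤ k) {ε η : ℝ} (hε : 0 < ε)
    (hεk : ε ≤ 1 / (2 * (k : ℝ))) (hη : 0 < η) (hd : 68 ≤ ε * d)
    (hlim : 4 * (d : ℝ) ^ (4 * k) * (3 / 4 : ℝ) ^ ⌊ε * d / 4⌋₊ ≤ η)
    (hG : ((2 * k + 1 : ℕ) : ℕ∞) ≤ G.egirth) (hT : T.IsTree)
    (hE : (T.edgeSet.ncard : ℝ) ≤ 1 / 4 * ε * (d : ℝ) ^ k)
    (hΔ : (T.maxDegree : ℝ) ≤ d - 2 * ε * d - 2) (N : OutNeighbourhoods G d) (v₁ : V)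
    (σ : SelectionRule V T r) :
    ENNReal.ofReal (1 - η) ≤ (embedLaw T r N k v₁ σ).toOuterMeasure (Success G T) := by
  classical
  have hn : (Fintype.card W : ℝ) ≤ 1 / 4 * ε * d ^ k + 1 := by
    rw [← hT.card_edgeFinset, SimpleGraph.edgeFinset, ← Set.ncard_eq_toFinset_card']
    push_cast
    linarith
  obtain ⟨K, rfl⟩ : ∃ K, k = K + 1 := ⟨k - 1, by omega⟩
  -- For `k = 1` the tree has at most `ε d / 4 + 1` vertices, too few for an overload, so the zero
  -- potential works.
  rcases Nat.eq_zero_or_pos K with rfl | hK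
  · refine one_sub_le_success hT N v₁ σ hη hε.le hΔ (fun _ => 0) (fun _ => zero_le) ?_ ?_
    · intro f past s v _ _ _ _ _
      simp
    · intro f past s v _ _ _ _ h
      have h1 : ((occupied N f v).card : ℝ) ≤ Fintype.card W := by
        exact_mod_cast card_occupied_le_card N f v
      rw [zero_add, pow_one] at hn
      linarith
  have hε1 : ε ≤ 1 / 2 := hεk.trans <| by
    apply one_div_le_one_div_of_le (by norm_num)
    push_cast
    have : (0 : ℝ) ≤ K := K.cast_nonneg
    linarith
  have hpos : 0 < (1 - ε) * d := by
    have : (0 : ℝ) ≤ d := d.cast_nonneg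
    nlinarith
  -- An overload means at least `⌊ε * d⌋₊ + 1 = M + 3` occupied chosen neighbours.
  set M := ⌊ε * d⌋₊ - 2 with hM
  set m := ⌊ε * d / 4⌋₊ with hm
  have hM2 : 68 ≤ ⌊ε * d⌋₊ := Nat.le_floor (by exact_mod_cast hd)
  have hmM : m ≤ M := by
    have h1 : (m : ℝ) ≤ ε * d / 4 := Nat.floor_le (by positivity)
    have h2 := Nat.lt_floor_add_one (ε * d)
    have h3 : ⌊ε * d⌋₊ = M + 2 := by omega
    rw [h3] at h2
    push_cast at h2
    have : (m : ℝ) ≤ M := by linarith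
    exact_mod_cast this
  refine one_sub_le_success hT N v₁ σ hη hε.le hΔ
    (potential T r N K m M (ENNReal.ofReal ((1 - ε) * d)⁻¹)) ?_ ?_ ?_
  · intro v
    exact (potential_placeRoot_le v).trans (initial_potential_le hε hεk hd hlim hn hm hM)
  · intro f past s v hf hpast hs hv hocc
    exact sum_potential_le hT hG hf hpast hs hv (inv_card_available_le hpos hocc)
  · intro f past s v hf hpast hs hv hocc
    refine one_le_potential hK hmM hT hG hf hs hv past ?_
    have := (Nat.floor_lt (by positivity)).2 hocc
    omega

end Success

end TreeEmbedding

theorem theorem4p1 (k : ℕ) (hk : 1 ≤ k) (ε : ℝ) (hε : 0 < ε) (hεk : ε ≤ 1 / (2 * (k : ℝ)))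
    (η : ℝ) (hη : 0 < η) :
    ∃ d₀ : ℕ, ∀ d : ℕ, d₀ ≤ d →
      ∀ (V : Type*) (G : SimpleGraph V),
        (∀ v, (d : ℕ∞) ≤ (G.neighborSet v).encard) →
        ((2 * k + 1 : ℕ) : ℕ∞) ≤ G.egirth →
      ∀ (W : Type*) [Fintype W] (T : SimpleGraph W) [DecidableRel T.Adj],
        T.IsTree →
        (T.edgeSet.ncard : ℝ) ≤ 1 / 4 * ε * (d : ℝ) ^ k →
        (T.maxDegree : ℝ) ≤ d - 2 * ε * d - 2 →
      ∀ (N : TreeEmbedding.OutNeighbourhoods G d) (r : W) (v₁ : V)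
        (σ : TreeEmbedding.SelectionRule V T r),
        ENNReal.ofReal (1 - η) ≤
          (TreeEmbedding.embedLaw T r N k v₁ σ).toOuterMeasure
            (TreeEmbedding.Success G T) := by
  obtain ⟨d₀, hd₀⟩ := TreeEmbedding.exists_degree_threshold k hε hη
  refine ⟨d₀, fun d hd V G _ hG W _ T _ hT hE hΔ N r v₁ σ => ?_⟩
  obtain ⟨h68, hlim⟩ := hd₀ d hd
  exact TreeEmbedding.embedLaw_success hk hε hεk hη h68 hlim hG hT hE hΔ N v₁ σ
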